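/- **Setting.** Let $n,m\ge 1$, $N=n+m$, and write $z=(x,y)\in\mathbb R^N=\mathbb R^n\times\mathbb R^m$; $dz$ is Lebesgue measure. *The function $\lambda$.* $\lambda:\mathbb R^n\to[0,\infty)$ is continuous, its zeros are isolated, and for all Euclidean balls $B_e\subset\mathbb R^n$ (with $2B_e$ the concentric ball of twice the radius) $$\int_{2B_e}\lambda\,dx\le C_1\int_{B_e}\lambda\,dx,\qquad \sup_{B_e}\lambda\le \frac{C_2}{|B_e|}\int_{B_e}\lambda\,dx .$$ For $z_0=(x_0,y_0)$ and $r>0$ put $\Lambda(z_0,r)=\sup_{|x-x_0|<r}\lambda(x)$ and $$Q(z_0,r)=\{(x,y):|x-x_0|<r,\ |y-y_0|<r\Lambda(z_0,r)\};$$ for $Q=Q(z_0,h)$ and $a>0$, $aQ=Q(z_0,ah)$. An absolutely continuous curve $\gamma=(\gamma_x,\gamma_y)$ is subunit if for almost every $t$, $\langle\gamma'(t),(\xi,\eta)\rangle^2\le|\xi|^2+\lambda(\gamma_x(t))^2|\eta|^2$ for all $(\xi,\eta)\in\mathbb R^n\times\mathbb R^m$; $\rho(z,w)$ is the infimum of all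 $T\ge0$ such that a subunit curve with domain $[0,T]$ joins $z$ and $w$. Let $\nabla_\lambda g=(\nabla_xg,\lambda\nabla_yg)$. *The weights.* $u,v$ are non-negative, non-trivial, locally integrable functions on $\mathbb R^N$, with $u(E)=\int_Eu\,dz$ and $v(E)=\int_Ev\,dz$, such that $u(2B)\le C_3u(B)$ and $v(2B)\le C_4v(B)$ for all $\rho$-balls $B$ (with $2B$ the concentric ball of twice the radius). Let $q>2$ and suppose that for every Lipschitz function $g$ on $\mathbb R^N$ and every $\rho$-ball $B$ of radius $r$, $$\Big[\frac1{u(B)}\int_B|g-m_B(g)|^q\,u\,dz\Big]^{1/q}\le C_5\,r\Big[\frac1{v(B)}\int_B|\nabla_\lambda g|^2\,v\,dz\Big]^{1/2},\qquad m_B(g)=\frac1{u(B)}\int_Bg\,u\,dz .$$ *The operator.* $Lf=\sum_{i,j}\partial_i(a_{ij}\partial_jf)$, where $(a_{ij})$ is a symmetric matrix of real measurable functions on $\mathbb R^N$ such that for almost every $z$ and all $\zeta=(\xi,\eta)\in\mathbb R^n\times\mathbb R^m$ $$v(z)(|\xi|^2+\lambda(x)^2|\eta|^2)\le\sum_{i,j}a_{ij}(z)\zeta_i\zeta_j\le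 u(z)(|\xi|^2+\lambda(x)^2|\eta|^2).$$ *The spaces.* For a bounded open set $\Omega$, $H(\Omega)$ is the completion of the space of Lipschitz functions on $\overline\Omega$ for the norm $\|f\|_H^2=a_0(f,f)+\int_\Omega f^2u\,dz$, where $a_0(f,g)=\sum_{i,j}\int_\Omega a_{ij}\,\partial_if\,\partial_jg\,dz$; $a_0$ is extended to $H(\Omega)$ by continuity. $H_0(\Omega)$ is the closure in $H(\Omega)$ of the Lipschitz functions with compact support in $\Omega$. The natural map $H(\Omega)\to L^2(\Omega,u\,dz)$ is written $f\mapsto\tilde f$. An $f\in H(\Omega)$ is non-negative if it is the limit in $H(\Omega)$ of non-negative Lipschitz functions on $\overline\Omega$, and a weak subsolution of $Lf=0$ if $a_0(f,\theta)\le0$ for all non-negative $\theta\in H_0(\Omega)$. **Proposition 4.2.** There are constants $C_{12}>0$ and $\delta>0$, depending only on $C_1,C_2,C_3,C_4,C_5,q,m,n$, such that in the above setting, for every $z_0\in\mathbb R^N$, every $h>0$, every non-negative weak subsolution $f\in H(Q)$ of $Lf=0$ on $Q=Q(z_0,h)$, every $a\in[\tfrac12,1)$ and every $p\ge2$, $$\Big(\operatorname*{ess\,sup}_{aQ}\tilde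 f\Big)^p\le\frac{C_{12}}{(1-a)^{\delta}}\,[p\,\mu(Q)]^{\frac{2q}{q-2}}\,\frac1{u(Q)}\int_Q\tilde f^{\,p}u\,dz,\qquad \mu(Q)=u(Q)^{1/2}v(Q)^{-1/2}.$$ Here the essential supremum is taken with respect to the measure $u\,dz$, and both sides may be $+\infty$. -/

import Mathlib

open MeasureTheory Set Filter Topology
open scoped ENNReal NNReal

noncomputable section

/-- `ℝ^N = ℝ^n × ℝ^m`, with points `z = (x, y)` and Lebesgue measure `volume`. -/
abbrev GPt (n m : ℕ) : Type := EuclideanSpace ℝ (Fin n) × EuclideanSpace ℝ (Fin m)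

namespace Grushin

variable {n m : ℕ}

/-- The canonical basis of `ℝ^n × ℝ^m`, indexed by `Fin n ⊕ Fin m`. -/
def basisVec : Fin n ⊕ Fin m → GPt n m
  | Sum.inl i => (EuclideanSpace.single i 1, 0)
  | Sum.inr j => (0, EuclideanSpace.single j 1)

/-- The partial derivative of `g` at `z` in the `i`-th coordinate (it is only used for
Lipschitz functions, which are differentiable almost everywhere). -/
def pderiv (i : Fin n ⊕ Fin m) (g : GPt n m → ℝ) (z : GPt n m) : ℝ :=
  fderiv ℝ g z (basisVec i)

/-- `|∇_λ g(z)|² = ∑ (∂g/∂x_i)² + λ(x)² ∑ (∂g/∂y_j)²`. -/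
def gradSq (lam : EuclideanSpace ℝ (Fin n) → ℝ) (g : GPt n m → ℝ) (z : GPt n m) : ℝ :=
  ∑ i : Fin n, pderiv (Sum.inl i) g z ^ 2 +
    ∑ j : Fin m, (lam z.1 * pderiv (Sum.inr j) g z) ^ 2

/-- The measure `w(z) dz`. -/
def weightMeasure (w : GPt n m → ℝ) : Measure (GPt n m) :=
  volume.withDensity fun z => ENNReal.ofReal (w z)

/-- `|ξ|² + λ(x)² |η|²` for `ζ = (ξ, η)`. -/
def grushinForm (lam : EuclideanSpace ℝ (Fin n) → ℝ) (z : GPt n m) (ζ : Fin n ⊕ Fin m → ℝ) : ℝ :=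
  ∑ i : Fin n, ζ (Sum.inl i) ^ 2 + lam z.1 ^ 2 * ∑ j : Fin m, ζ (Sum.inr j) ^ 2

/-! ### The function `λ`, the rectangles and the metric -/

/-- `λ` is non-negative, continuous, and its zeros are isolated. -/
structure IsAdmissible (lam : EuclideanSpace ℝ (Fin n) → ℝ) : Prop where
  nonneg : ∀ x, 0 ≤ lam x
  continuous : Continuous lam
  zeros_isolated : ∀ x, lam x = 0 → ∀ᶠ x' in 𝓝[≠] x, lam x' ≠ 0

/-- `λ` is doubling for Euclidean balls and Lebesgue measure, with constant `C`. -/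
def LamDoubling (lam : EuclideanSpace ℝ (Fin n) → ℝ) (C : ℝ) : Prop :=
  ∀ (x : EuclideanSpace ℝ (Fin n)) (r : ℝ), 0 < r →
    ∫ x' in Metric.ball x (2 * r), lam x' ≤ C * ∫ x' in Metric.ball x r, lam x'

/-- The supremum of `λ` on every Euclidean ball is at most `C` times its mean value there. -/
def LamSupMean (lam : EuclideanSpace ℝ (Fin n) → ℝ) (C : ℝ) : Prop :=
  ∀ (x : EuclideanSpace ℝ (Fin n)) (r : ℝ), 0 < r →
    sSup (lam '' Metric.ball x r) ≤ C * ⨍ x' in Metric.ball x r, lam x'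

/-- `Λ(z₀, r)`, the supremum of `λ` on the Euclidean ball of centre `x₀` and radius `r`. -/
def Lam (lam : EuclideanSpace ℝ (Fin n) → ℝ) (z₀ : GPt n m) (r : ℝ) : ℝ :=
  sSup (lam '' Metric.ball z₀.1 r)

/-- The rectangle `Q(z₀, r)`. -/
def rect (lam : EuclideanSpace ℝ (Fin n) → ℝ) (z₀ : GPt n m) (r : ℝ) : Set (GPt n m) :=
  {z | ‖z.1 - z₀.1‖ < r ∧ ‖z.2 - z₀.2‖ < r * Lam lam z₀ r}

/-- `γ`, restricted to `[0, T]`, is an absolutely continuous subunit curve. -/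
def IsSubunit (lam : EuclideanSpace ℝ (Fin n) → ℝ) (T : ℝ) (γ : ℝ → GPt n m) : Prop :=
  AbsolutelyContinuousOnInterval γ 0 T ∧
    ∀ᵐ t ∂(volume.restrict (Icc 0 T)),
      ∀ (ξ : EuclideanSpace ℝ (Fin n)) (η : EuclideanSpace ℝ (Fin m)),
        (inner ℝ (deriv γ t).1 ξ + inner ℝ (deriv γ t).2 η) ^ 2 ≤
          ‖ξ‖ ^ 2 + lam (γ t).1 ^ 2 * ‖η‖ ^ 2

/-- `ρ(z, w)`: the infimum of all `T ≥ 0` for which a subunit curve with domain `[0, T]`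
joins `z` to `w`. -/
def rho (lam : EuclideanSpace ℝ (Fin n) → ℝ) (z w : GPt n m) : ℝ≥0∞ :=
  ⨅ (T : ℝ≥0) (_ : ∃ γ : ℝ → GPt n m, IsSubunit lam T γ ∧ γ 0 = z ∧ γ T = w), (T : ℝ≥0∞)

/-- The `ρ`-ball `B(z, r)`. -/
def rhoBall (lam : EuclideanSpace ℝ (Fin n) → ℝ) (z : GPt n m) (r : ℝ) : Set (GPt n m) :=
  {w | rho lam z w < ENNReal.ofReal r}

/-! ### Weights and the Sobolev-Poincaré inequality -/

/-- A weight: a non-negative, non-trivial, locally integrable function. -/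
structure IsWeight (w : GPt n m → ℝ) : Prop where
  nonneg : ∀ z, 0 ≤ w z
  locallyIntegrable : LocallyIntegrable w
  nontrivial : ¬ w =ᵐ[volume] 0

/-- `w` is doubling with respect to the metric `ρ`, with constant `C`. -/
def WeightDoubling (lam : EuclideanSpace ℝ (Fin n) → ℝ) (w : GPt n m → ℝ) (C : ℝ) : Prop :=
  ∀ (z : GPt n m) (r : ℝ), 0 < r →
    weightMeasure w (rhoBall lam z (2 * r)) ≤
      ENNReal.ofReal C * weightMeasure w (rhoBall lam z r)

/-- The two-weight Sobolev-Poincaré inequality with exponent `q` and constant `C`, for all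
Lipschitz functions on `ℝ^N` and all `ρ`-balls. Here `⨍ z in B, g z ∂(weightMeasure w)` is
`w(B)⁻¹ ∫_B g w`. -/
def SobolevPoincare (lam : EuclideanSpace ℝ (Fin n) → ℝ) (u v : GPt n m → ℝ) (q C : ℝ) : Prop :=
  ∀ g : GPt n m → ℝ, (∃ K : ℝ≥0, LipschitzWith K g) →
    ∀ (z₀ : GPt n m) (r : ℝ), 0 < r →
      (⨍ z in rhoBall lam z₀ r,
          |g z - ⨍ w in rhoBall lam z₀ r, g w ∂(weightMeasure u)| ^ q
            ∂(weightMeasure u)) ^ (1 / q) ≤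
        C * r * (⨍ z in rhoBall lam z₀ r, gradSq lam g z ∂(weightMeasure v)) ^ (1 / 2 : ℝ)

/-! ### The operator and the space `H(Ω)` -/

/-- The data `λ, u, v, A` of a degenerate elliptic operator `L f = ∑ ∂_i (a_ij ∂_j f)`. -/
structure Operator (n m : ℕ) where
  /-- the function `λ` -/
  lam : EuclideanSpace ℝ (Fin n) → ℝ
  /-- the upper weight -/
  u : GPt n m → ℝ
  /-- the lower weight -/
  v : GPt n m → ℝ
  /-- the coefficient matrix -/
  A : GPt n m → Matrix (Fin n ⊕ Fin m) (Fin n ⊕ Fin m) ℝ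
  lam_admissible : IsAdmissible lam
  u_weight : IsWeight u
  v_weight : IsWeight v
  A_measurable : ∀ i j, AEMeasurable fun z => A z i j
  A_symm : ∀ z, (A z).IsSymm
  ellipticity : ∀ᵐ z, ∀ ζ : Fin n ⊕ Fin m → ℝ,
    v z * grushinForm lam z ζ ≤ ∑ i, ∑ j, A z i j * ζ i * ζ j ∧
      ∑ i, ∑ j, A z i j * ζ i * ζ j ≤ u z * grushinForm lam z ζ

/-- A bounded open subset of `ℝ^N`. -/
structure Domain (n m : ℕ) where
  /-- the underlying set -/
  carrier : Set (GPt n m)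
  isOpen : IsOpen carrier
  isBounded : Bornology.IsBounded carrier

/-- The rectangle `Q(z₀, r)` as a bounded open set. -/
def rectDomain (lam : EuclideanSpace ℝ (Fin n) → ℝ) (z₀ : GPt n m) (r : ℝ) : Domain n m where
  carrier := rect lam z₀ r
  isOpen := by
    have h1 : IsOpen {z : GPt n m | ‖z.1 - z₀.1‖ < r} :=
      isOpen_lt (by fun_prop) continuous_const
    have h2 : IsOpen {z : GPt n m | ‖z.2 - z₀.2‖ < r * Lam lam z₀ r} :=
      isOpen_lt (by fun_prop) continuous_const
    exact h1.inter h2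
  isBounded := by
    refine (Metric.isBounded_ball (x := z₀.1) (r := r)).prod
      (Metric.isBounded_ball (x := z₀.2) (r := r * Lam lam z₀ r)) |>.subset ?_
    intro z hz
    exact ⟨by simpa [dist_eq_norm] using hz.1, by simpa [dist_eq_norm] using hz.2⟩

/-- The functions that are Lipschitz continuous on `closure Ω`. Values outside `closure Ω` are
irrelevant: they do not enter the norm below. -/
def lipSubmodule (Ω : Domain n m) : Submodule ℝ (GPt n m → ℝ) where
  carrier := {f | ∃ K : ℝ≥0, LipschitzOnWith K f (closure Ω.carrier)}
  zero_mem' := ⟨0, by intro x _ y _; simp⟩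
  add_mem' := by
    rintro f g ⟨K, hf⟩ ⟨K', hg⟩
    exact ⟨K + K', hf.add hg⟩
  smul_mem' := by
    rintro c f ⟨K, hf⟩
    refine ⟨‖c‖₊ * K, LipschitzOnWith.of_dist_le_mul fun x hx y hy => ?_⟩
    have h := hf.dist_le_mul x hx y hy
    simp only [Pi.smul_apply, smul_eq_mul, Real.dist_eq, ← mul_sub, abs_mul] at h ⊢
    simp only [NNReal.coe_mul, coe_nnnorm, Real.norm_eq_abs, mul_assoc]
    exact mul_le_mul_of_nonneg_left h (abs_nonneg c)

/-- `Lip(closure Ω)`, to be endowed with the norm of `H(Ω)` attached to the operator `D`. -/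
def Lip (_D : Operator n m) (Ω : Domain n m) : Type := lipSubmodule Ω

variable {D : Operator n m} {Ω : Domain n m}

instance : AddCommGroup (Lip D Ω) := inferInstanceAs (AddCommGroup (lipSubmodule Ω))

instance : Module ℝ (Lip D Ω) := inferInstanceAs (Module ℝ (lipSubmodule Ω))

/-- The underlying function. -/
def Lip.toFun (f : Lip D Ω) : GPt n m → ℝ := Subtype.val (p := (· ∈ lipSubmodule Ω)) f

instance : CoeFun (Lip D Ω) fun _ => GPt n m → ℝ := ⟨Lip.toFun⟩

theorem Lip.lipschitz (f : Lip D Ω) : ∃ K : ℝ≥0, LipschitzOnWith K f (closure Ω.carrier) :=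
  Subtype.property (p := (· ∈ lipSubmodule Ω)) f

@[simp] theorem Lip.add_apply (f g : Lip D Ω) (z : GPt n m) : (f + g) z = f z + g z := rfl

@[simp] theorem Lip.smul_apply (c : ℝ) (f : Lip D Ω) (z : GPt n m) : (c • f) z = c * f z := rfl

/-- The form `a₀(f, g) = ∑ ∫_Ω a_ij ∂_i f ∂_j g dz` on Lipschitz functions. -/
def energy (f g : Lip D Ω) : ℝ :=
  ∑ i, ∑ j, ∫ z in Ω.carrier, D.A z i j * pderiv i f z * pderiv j g z

/-- The form `∫_Ω f g u dz` on Lipschitz functions. -/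
def mass (f g : Lip D Ω) : ℝ := ∫ z in Ω.carrier, f z * g z * D.u z

/-! Integrability facts which show that the two forms are finite and bilinear. -/

theorem isCompact_closure (Ω : Domain n m) : IsCompact (closure Ω.carrier) :=
  Ω.isBounded.isCompact_closure

theorem u_integrableOn (D : Operator n m) (Ω : Domain n m) : IntegrableOn D.u Ω.carrier :=
  (D.u_weight.locallyIntegrable.integrableOn_isCompact (isCompact_closure Ω)).mono_set
    subset_closure

instance : (volume : Measure (GPt n m)).IsAddHaarMeasure := by
  rw [Measure.volume_eq_prod]
  infer_instance

theorem ae_differentiableAt (f : Lip D Ω) :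
    ∀ᵐ z ∂(volume.restrict Ω.carrier), DifferentiableAt ℝ (f : GPt n m → ℝ) z := by
  obtain ⟨K, hK⟩ := f.lipschitz
  rw [ae_restrict_iff' Ω.isOpen.measurableSet]
  filter_upwards [hK.ae_differentiableWithinAt_of_mem (μ := volume)] with z hz hzΩ
  exact (hz (subset_closure hzΩ)).differentiableAt
    (mem_of_superset (Ω.isOpen.mem_nhds hzΩ) subset_closure)

theorem pderiv_bound (f : Lip D Ω) : ∃ M : ℝ, 0 ≤ M ∧ ∀ i, ∀ z ∈ Ω.carrier,
    |pderiv i (f : GPt n m → ℝ) z| ≤ M := by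
  obtain ⟨K, hK⟩ := f.lipschitz
  refine ⟨K, K.2, fun i z hz => ?_⟩
  have h1 : ‖fderiv ℝ (f : GPt n m → ℝ) z‖ ≤ K :=
    norm_fderiv_le_of_lipschitzOn ℝ
      (mem_of_superset (Ω.isOpen.mem_nhds hz) subset_closure) hK
  have h2 : ‖(basisVec i : GPt n m)‖ ≤ 1 := by
    cases i <;> simp [basisVec, Prod.norm_def]
  calc |pderiv i (f : GPt n m → ℝ) z| ≤ ‖fderiv ℝ (f : GPt n m → ℝ) z‖ * ‖(basisVec i : GPt n m)‖ :=
        (fderiv ℝ (f : GPt n m → ℝ) z).le_opNorm _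
    _ ≤ K * 1 := mul_le_mul h1 h2 (norm_nonneg _) K.2
    _ = K := mul_one _

theorem pderiv_measurable (i : Fin n ⊕ Fin m) (f : GPt n m → ℝ) : Measurable (pderiv i f) :=
  measurable_fderiv_apply_const ℝ f _

theorem coeff_bound (D : Operator n m) : ∀ᵐ z, ∀ i j, |D.A z i j| ≤ D.u z * (1 + D.lam z.1 ^ 2) := by
  filter_upwards [D.ellipticity] with z hz i j
  have hu := D.u_weight.nonneg z
  have hl : 0 ≤ D.lam z.1 ^ 2 := sq_nonneg _
  have hform : ∀ ζ : Fin n ⊕ Fin m → ℝ, 0 ≤ grushinForm D.lam z ζ := fun ζ => by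
    unfold grushinForm; positivity
  have hpsd : ∀ ζ : Fin n ⊕ Fin m → ℝ, 0 ≤ ∑ i, ∑ j, D.A z i j * ζ i * ζ j := fun ζ =>
    (mul_nonneg (D.v_weight.nonneg z) (hform ζ)).trans (hz ζ).1
  have key : ∀ s t : ℝ, ∑ k, ∑ l, D.A z k l * (s * (if k = i then 1 else 0) + t * (if k = j then 1 else 0))
      * (s * (if l = i then 1 else 0) + t * (if l = j then 1 else 0)) =
      s * s * D.A z i i + 2 * s * t * D.A z i j + t * t * D.A z j j := by
    intro s t
    have hs : D.A z j i = D.A z i j := (D.A_symm z).apply i j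
    simp only [mul_add, add_mul, Finset.sum_add_distrib, mul_ite, mul_one, mul_zero, ite_mul,
      zero_mul, Finset.sum_ite_eq', Finset.mem_univ, if_true]
    simp [hs]
    ring
  have hdiag : ∀ k, D.A z k k ≤ D.u z * (1 + D.lam z.1 ^ 2) := by
    intro k
    have h := (hz (Pi.single k 1)).2
    have e : ∑ i, ∑ j, D.A z i j * (Pi.single k 1 : Fin n ⊕ Fin m → ℝ) i *
        (Pi.single k 1 : Fin n ⊕ Fin m → ℝ) j = D.A z k k := by
      simp [Pi.single_apply]
    rw [e] at h
    refine h.trans (mul_le_mul_of_nonneg_left ?_ hu)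
    rcases k with k | k <;> simp [grushinForm, Pi.single_apply, hl]
  have h1 := hpsd (fun k => 1 * (if k = i then 1 else 0) + 1 * (if k = j then 1 else 0))
  have h2 := hpsd (fun k => 1 * (if k = i then 1 else 0) + (-1) * (if k = j then 1 else 0))
  rw [key] at h1 h2
  rw [abs_le]
  constructor <;> linarith [hdiag i, hdiag j]

theorem energy_integrable (f g : Lip D Ω) (i j : Fin n ⊕ Fin m) :
    IntegrableOn (fun z => D.A z i j * pderiv i f z * pderiv j g z) Ω.carrier := by
  obtain ⟨M, hM0, hM⟩ := pderiv_bound f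
  obtain ⟨M', hM0', hM'⟩ := pderiv_bound g
  obtain ⟨S, hS⟩ := (isCompact_closure Ω).exists_bound_of_continuousOn
    (f := fun z : GPt n m => 1 + D.lam z.1 ^ 2)
    ((continuous_const.add ((D.lam_admissible.continuous.comp continuous_fst).pow 2)).continuousOn)
  refine Integrable.mono' ((u_integrableOn D Ω).const_mul (S * M * M')) ?_ ?_
  · exact (((D.A_measurable i j).restrict.mul (pderiv_measurable i f).aemeasurable).mul
      (pderiv_measurable j g).aemeasurable).aestronglyMeasurable
  · rw [ae_restrict_iff' Ω.isOpen.measurableSet]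
    filter_upwards [coeff_bound D] with z hz hzΩ
    have hu := D.u_weight.nonneg z
    have hSz := (le_abs_self _).trans (hS z (subset_closure hzΩ))
    have hS0 : 0 ≤ S := (norm_nonneg _).trans (hS z (subset_closure hzΩ))
    have h1 : |D.A z i j| ≤ D.u z * S :=
      (hz i j).trans (mul_le_mul_of_nonneg_left hSz hu)
    rw [Real.norm_eq_abs, abs_mul, abs_mul]
    calc |D.A z i j| * |pderiv i (f : GPt n m → ℝ) z| * |pderiv j (g : GPt n m → ℝ) z|
        ≤ (D.u z * S) * M * M' := by
          have := hM i z hzΩ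
          have := hM' j z hzΩ
          gcongr
      _ = S * M * M' * D.u z := by ring

theorem lip_bound (f : Lip D Ω) : ∃ M : ℝ, 0 ≤ M ∧ ∀ z ∈ Ω.carrier, |f z| ≤ M := by
  obtain ⟨K, hK⟩ := f.lipschitz
  obtain ⟨M, hM⟩ := (isCompact_closure Ω).exists_bound_of_continuousOn hK.continuousOn
  exact ⟨max M 0, le_max_right _ _, fun z hz => (hM z (subset_closure hz)).trans (le_max_left _ _)⟩

theorem lip_aestronglyMeasurable (f : Lip D Ω) :
    AEStronglyMeasurable (f : GPt n m → ℝ) (volume.restrict Ω.carrier) := by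
  obtain ⟨K, hK⟩ := f.lipschitz
  exact (hK.continuousOn.mono subset_closure).aestronglyMeasurable Ω.isOpen.measurableSet

theorem mass_integrable (f g : Lip D Ω) :
    IntegrableOn (fun z => f z * g z * D.u z) Ω.carrier := by
  obtain ⟨M, hM0, hM⟩ := lip_bound f
  obtain ⟨M', hM0', hM'⟩ := lip_bound g
  refine Integrable.mono' ((u_integrableOn D Ω).const_mul (M * M')) ?_ ?_
  · exact ((lip_aestronglyMeasurable f).mul (lip_aestronglyMeasurable g)).mul
      (u_integrableOn D Ω).aestronglyMeasurable
  · rw [ae_restrict_iff' Ω.isOpen.measurableSet]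
    refine Eventually.of_forall fun z hz => ?_
    rw [Real.norm_eq_abs, abs_mul, abs_mul, abs_of_nonneg (D.u_weight.nonneg z)]
    have := hM z hz
    have := hM' z hz
    have := D.u_weight.nonneg z
    gcongr

theorem energy_symm (f g : Lip D Ω) : energy g f = energy f g := by
  unfold energy
  rw [Finset.sum_comm]
  refine Finset.sum_congr rfl fun i _ => Finset.sum_congr rfl fun j _ => ?_
  refine integral_congr_ae (Eventually.of_forall fun z => ?_)
  have hs : D.A z j i = D.A z i j := (D.A_symm z).apply i j
  simp only [hs]
  ring

theorem energy_add_left (f g h : Lip D Ω) : energy (f + g) h = energy f h + energy g h := by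
  unfold energy
  simp only [← Finset.sum_add_distrib]
  refine Finset.sum_congr rfl fun i _ => Finset.sum_congr rfl fun j _ => ?_
  rw [← integral_add (energy_integrable f h i j) (energy_integrable g h i j)]
  refine integral_congr_ae ?_
  filter_upwards [ae_differentiableAt f, ae_differentiableAt g] with z hf hg
  have : pderiv i ((f + g : Lip D Ω) : GPt n m → ℝ) z = pderiv i f z + pderiv i g z := by
    have e : ((f + g : Lip D Ω) : GPt n m → ℝ) = (f : GPt n m → ℝ) + (g : GPt n m → ℝ) := rfl
    simp only [pderiv]
    rw [e, fderiv_add hf hg]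
    rfl
  rw [this]
  ring

theorem energy_smul_left (c : ℝ) (f h : Lip D Ω) : energy (c • f) h = c * energy f h := by
  unfold energy
  simp only [Finset.mul_sum]
  refine Finset.sum_congr rfl fun i _ => Finset.sum_congr rfl fun j _ => ?_
  rw [← integral_const_mul]
  refine integral_congr_ae ?_
  filter_upwards [ae_differentiableAt f] with z hf
  have : pderiv i ((c • f : Lip D Ω) : GPt n m → ℝ) z = c * pderiv i f z := by
    have e : ((c • f : Lip D Ω) : GPt n m → ℝ) = c • (f : GPt n m → ℝ) := rfl
    simp only [pderiv]
    rw [e, fderiv_const_smul hf]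
    rfl
  rw [this]
  ring

theorem energy_self_nonneg (f : Lip D Ω) : 0 ≤ energy f f := by
  unfold energy
  have e : ∑ i, ∑ j, ∫ z in Ω.carrier, D.A z i j * pderiv i f z * pderiv j f z =
      ∫ z in Ω.carrier, ∑ i, ∑ j, D.A z i j * pderiv i f z * pderiv j f z := by
    rw [integral_finsetSum _ fun i _ => integrable_finsetSum _ fun j _ => energy_integrable f f i j]
    refine Finset.sum_congr rfl fun i _ => ?_
    rw [integral_finsetSum _ fun j _ => energy_integrable f f i j]
  rw [e]
  refine integral_nonneg_of_ae (ae_restrict_of_ae ?_)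
  filter_upwards [D.ellipticity] with z hz
  refine le_trans (mul_nonneg (D.v_weight.nonneg z) ?_) (hz fun i => pderiv i f z).1
  unfold grushinForm
  positivity

theorem mass_self_nonneg (f : Lip D Ω) : 0 ≤ mass f f :=
  integral_nonneg fun z => mul_nonneg (mul_self_nonneg _) (D.u_weight.nonneg z)

/-- The inner product of `H(Ω)` on Lipschitz functions, `a₀(f, g) + ∫_Ω f g u dz`. -/
@[reducible]
def lipCore (D : Operator n m) (Ω : Domain n m) : PreInnerProductSpace.Core ℝ (Lip D Ω) where
  inner f g := energy f g + mass f g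
  conj_inner_symm f g := by
    simp only [conj_trivial]
    rw [energy_symm]
    congr 1
    exact integral_congr_ae (Eventually.of_forall fun z => by ring)
  re_inner_nonneg f := add_nonneg (energy_self_nonneg f) (mass_self_nonneg f)
  add_left f g h := by
    have : mass (f + g) h = mass f h + mass g h := by
      unfold mass
      rw [← integral_add (mass_integrable f h) (mass_integrable g h)]
      exact integral_congr_ae (Eventually.of_forall fun z => by simp only [Lip.add_apply]; ring)
    rw [energy_add_left, this]
    ring
  smul_left f h c := by
    have : mass (c • f) h = c * mass f h := by
      unfold mass
      rw [← integral_const_mul]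
      exact integral_congr_ae (Eventually.of_forall fun z => by simp only [Lip.smul_apply]; ring)
    simp only [conj_trivial]
    rw [energy_smul_left, this]
    ring

/-- The (semi)norm `‖f‖² = a₀(f, f) + ∫_Ω f² u dz` on `Lip(closure Ω)`. -/
instance : SeminormedAddCommGroup (Lip D Ω) :=
  @InnerProductSpace.Core.toSeminormedAddCommGroup ℝ (Lip D Ω) _ _ _ (lipCore D Ω)

instance : InnerProductSpace ℝ (Lip D Ω) := InnerProductSpace.ofCore (lipCore D Ω)

theorem lip_inner (f g : Lip D Ω) : inner ℝ f g = energy f g + mass f g := rfl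

theorem lip_norm_sq (f : Lip D Ω) : ‖f‖ ^ 2 = energy f f + mass f f := by
  rw [← real_inner_self_eq_norm_sq, lip_inner]

/-- `H(Ω)`: the completion of `Lip(closure Ω)`. -/
abbrev H (D : Operator n m) (Ω : Domain n m) : Type := UniformSpace.Completion (Lip D Ω)

/-- `L²(Ω, u dz)`. -/
abbrev L2u (D : Operator n m) (Ω : Domain n m) : Type :=
  Lp ℝ 2 ((weightMeasure D.u).restrict Ω.carrier)

theorem u_aemeasurable (D : Operator n m) :
    AEMeasurable fun z => ENNReal.ofReal (D.u z) :=
  D.u_weight.locallyIntegrable.aestronglyMeasurable.aemeasurable.ennreal_ofReal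

theorem weight_restrict (w : GPt n m → ℝ) (Ω : Domain n m) :
    (weightMeasure w).restrict Ω.carrier =
      (volume.restrict Ω.carrier).withDensity fun z => ENNReal.ofReal (w z) :=
  restrict_withDensity Ω.isOpen.measurableSet _

theorem lip_memLp (f : Lip D Ω) :
    MemLp (f : GPt n m → ℝ) 2 ((weightMeasure D.u).restrict Ω.carrier) := by
  obtain ⟨M, -, hM⟩ := lip_bound f
  have : IsFiniteMeasure ((weightMeasure D.u).restrict Ω.carrier) := by
    rw [weight_restrict]
    exact isFiniteMeasure_withDensity_ofReal (u_integrableOn D Ω).2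
  refine MemLp.of_bound ?_ M ?_
  · rw [weight_restrict]
    exact (lip_aestronglyMeasurable f).mono_ac (withDensity_absolutelyContinuous _ _)
  · rw [ae_restrict_iff' Ω.isOpen.measurableSet]
    exact Eventually.of_forall hM

/-- The class of a Lipschitz function in `L²(Ω, u dz)`. -/
def lipToL2 (D : Operator n m) (Ω : Domain n m) : Lip D Ω →ₗ[ℝ] L2u D Ω where
  toFun f := (lip_memLp f).toLp _
  map_add' f g := (lip_memLp f).toLp_add (lip_memLp g)
  map_smul' c f := (lip_memLp f).toLp_const_smul c

theorem lipToL2_inner (f g : Lip D Ω) : inner ℝ (lipToL2 D Ω f) (lipToL2 D Ω g) = mass f g := by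
  rw [L2.inner_def]
  have h : ∫ z, inner ℝ (lipToL2 D Ω f z) (lipToL2 D Ω g z)
      ∂((weightMeasure D.u).restrict Ω.carrier) =
      ∫ z, f z * g z ∂((weightMeasure D.u).restrict Ω.carrier) := by
    refine integral_congr_ae ?_
    filter_upwards [(lip_memLp f).coeFn_toLp, (lip_memLp g).coeFn_toLp] with z hf hg
    change inner ℝ ((lip_memLp f).toLp _ z) ((lip_memLp g).toLp _ z) = _
    rw [hf, hg]
    simp [mul_comm]
  rw [h, weight_restrict, integral_withDensity_eq_integral_toReal_smul₀ (u_aemeasurable D).restrict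
    (Eventually.of_forall fun z => ENNReal.ofReal_lt_top)]
  refine integral_congr_ae (Eventually.of_forall fun z => ?_)
  simp only [ENNReal.toReal_ofReal (D.u_weight.nonneg z), smul_eq_mul]
  ring

theorem lipToL2_norm_le (f : Lip D Ω) : ‖lipToL2 D Ω f‖ ≤ 1 * ‖f‖ := by
  rw [one_mul]
  refine le_of_sq_le_sq ?_ (norm_nonneg _)
  rw [lip_norm_sq, ← real_inner_self_eq_norm_sq, lipToL2_inner]
  linarith [energy_self_nonneg f]

/-- The natural map `H(Ω) → L²(Ω, u dz)`, `f ↦ f̃`: the continuous extension of `lipToL2`. -/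
def tilde : H D Ω →L[ℝ] L2u D Ω :=
  ((lipToL2 D Ω).mkContinuous 1 lipToL2_norm_le).extend UniformSpace.Completion.toComplL

theorem tilde_coe (f : Lip D Ω) : tilde (f : H D Ω) = lipToL2 D Ω f :=
  ContinuousLinearMap.extend_eq _ UniformSpace.Completion.denseRange_coe
    (UniformSpace.Completion.isUniformInducing_coe _) f

/-- The form `a₀` on `H(Ω)`. By `a0_coe` and `a0_continuous` it is the unique continuous
extension of the form `energy` from Lipschitz functions. -/
def a0 (f g : H D Ω) : ℝ := inner ℝ f g - inner ℝ (tilde f) (tilde g)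

theorem a0_coe (f g : Lip D Ω) : a0 (f : H D Ω) (g : H D Ω) = energy f g := by
  unfold a0
  rw [UniformSpace.Completion.inner_coe, tilde_coe, tilde_coe, lipToL2_inner, lip_inner]
  ring

theorem a0_continuous : Continuous fun p : H D Ω × H D Ω => a0 p.1 p.2 := by
  unfold a0
  fun_prop

/-- `f ∈ H(Ω)` is non-negative: it is a limit of non-negative Lipschitz functions. -/
def IsNonneg (f : H D Ω) : Prop :=
  ∃ F : ℕ → Lip D Ω, (∀ k, ∀ z ∈ closure Ω.carrier, 0 ≤ F k z) ∧
    Tendsto (fun k => (F k : H D Ω)) atTop (𝓝 f)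

/-- `H₀(Ω)`: the closure in `H(Ω)` of the Lipschitz functions with compact support in `Ω`. -/
def H0 (D : Operator n m) (Ω : Domain n m) : Set (H D Ω) :=
  closure ((fun φ : Lip D Ω => (φ : H D Ω)) ''
    {φ | ∃ K, IsCompact K ∧ K ⊆ Ω.carrier ∧ ∀ z ∈ closure Ω.carrier, z ∉ K → φ z = 0})

/-- `f ∈ H(Ω)` is a weak subsolution of `L f = 0`. -/
def IsSubsolution (f : H D Ω) : Prop := ∀ θ ∈ H0 D Ω, IsNonneg θ → a0 f θ ≤ 0

/-- `μ(Q) = u(Q)^{1/2} v(Q)^{-1/2}`. -/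
def muRatio (D : Operator n m) (Q : Set (GPt n m)) : ℝ≥0∞ :=
  weightMeasure D.u Q ^ (1 / 2 : ℝ) * weightMeasure D.v Q ^ (-(1 / 2) : ℝ)

end Grushin

end

noncomputable section

namespace Grushin

variable {n m : ℕ}

/-! ### Rectangles and metric balls -/

/-! The proof is Moser's iteration, run for elements of a completion that carry no pointwise
gradient of their own.

One step combines two inequalities. Take a bounded Lipschitz `F ≥ 0`, a cutoff `η`, and the power
`H(t) = t^β`, continued linearly beyond a level `N`. Testing with `η² G(F)`, where `G' = (H')²`, and
using both ellipticity bounds gives a Caccioppoli inequality (`integral_gradSq_le`). It bounds the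
`v`-energy of `η H(F)` by `4 a₀(F, η² G(F))` plus a multiple of `β² |∇_λ η|²` times the `u`-integral
of `H(F)²`. For a subsolution the first term is non-positive. The Sobolev-Poincaré inequality then
raises the integrability of `H(F)` from exponent `2` to exponent `q` (`sobolev_rect`). The energy is
averaged against `v` and the mass against `u`, so each step costs exactly one factor `μ(Q) =
u(Q)^{1/2} v(Q)^{-1/2}`.

A subsolution `f` is only a limit in `H(Q)` of Lipschitz functions `F_k`, and these need not be
subsolutions. For fixed `N` the test functions built from `F_k` stay bounded in `H(Q)`, so `a₀(F_k,
η² G(F_k))` is at most `a₀(F_k - f, η² G(F_k))`, which tends to `0`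
(`IsSubsolution.energy_testFun_le`). Linear growth of `H` at infinity is what makes this work.
Fatou's lemma in `k`, and again as `N → ∞`, yields the reverse Hölder inequality `reverse_holder`,
with values in `[0, ∞]`.

The iteration takes `2β = p χ^i` with `χ = q/2`, on rectangles shrinking geometrically from `Q` to
`aQ`. The costs of the steps are raised to the powers `2 χ^{-i}`, whose sum `2q/(q-2)` is the
exponent of both `p μ(Q)` and `1/(1-a)`. The left-hand means bound the essential supremum in the
limit (`moser_iteration`, `essSup_rpow_le`).

The hypotheses concern `ρ`-balls and the conclusion concerns rectangles. The link is `B(z, r) ⊆ Q(z,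
r) ⊆ B(z, 6r)`, together with the doubling of the weights. -/

theorem bddAbove_lam {lam : EuclideanSpace ℝ (Fin n) → ℝ} (hl : Continuous lam)
    (x : EuclideanSpace ℝ (Fin n)) (r : ℝ) : BddAbove (lam '' Metric.ball x r) :=
  ((isCompact_closedBall x r).bddAbove_image hl.continuousOn).mono
    (image_mono Metric.ball_subset_closedBall)

theorem le_Lam {lam : EuclideanSpace ℝ (Fin n) → ℝ} (hl : Continuous lam) {z₀ : GPt n m} {r : ℝ}
    {x : EuclideanSpace ℝ (Fin n)} (hx : ‖x - z₀.1‖ < r) : lam x ≤ Lam lam z₀ r :=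
  le_csSup (bddAbove_lam hl _ _) ⟨x, by simpa [dist_eq_norm] using hx, rfl⟩

theorem Lam_mono {lam : EuclideanSpace ℝ (Fin n) → ℝ} (hl : Continuous lam) {z₀ : GPt n m}
    {r s : ℝ} (hr : 0 < r) (hrs : r ≤ s) : Lam lam z₀ r ≤ Lam lam z₀ s :=
  csSup_le_csSup (bddAbove_lam hl _ _) ((Metric.nonempty_ball.2 hr).image _)
    (image_mono (Metric.ball_subset_ball hrs))

/-- Zeros of `λ` are isolated and `ℝ^n` has no isolated points when `n ≥ 1`, so every ball contains
a point where `λ` is positive. -/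
theorem Lam_pos (hn : 1 ≤ n) {lam : EuclideanSpace ℝ (Fin n) → ℝ} (hl : IsAdmissible lam)
    (z₀ : GPt n m) {r : ℝ} (hr : 0 < r) : 0 < Lam lam z₀ r := by
  have : Nonempty (Fin n) := ⟨⟨0, hn⟩⟩
  by_cases h0 : lam z₀.1 = 0
  · have h1 : ∀ᶠ x in 𝓝[≠] z₀.1, x ∈ Metric.ball z₀.1 r :=
      mem_nhdsWithin_of_mem_nhds (Metric.ball_mem_nhds _ hr)
    obtain ⟨x, hx, hxr⟩ := ((hl.zeros_isolated _ h0).and h1).exists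
    exact (lt_of_le_of_ne (hl.nonneg x) (Ne.symm hx)).trans_le
      (le_Lam hl.continuous (by simpa [dist_eq_norm] using hxr))
  · exact (lt_of_le_of_ne (hl.nonneg _) (Ne.symm h0)).trans_le
      (le_Lam hl.continuous (by simpa using hr))

theorem rect_mono {lam : EuclideanSpace ℝ (Fin n) → ℝ} (hl : IsAdmissible lam)
    {z₀ : GPt n m} {r s : ℝ} (hr : 0 < r) (hrs : r ≤ s) : rect lam z₀ r ⊆ rect lam z₀ s := by
  rintro z ⟨h1, h2⟩
  refine ⟨h1.trans_le hrs, h2.trans_le ?_⟩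
  have h0 : 0 ≤ Lam lam z₀ r := (hl.nonneg z₀.1).trans
    (le_Lam hl.continuous (by simpa using hr))
  exact mul_le_mul hrs (Lam_mono hl.continuous hr hrs) h0 (hr.le.trans hrs)

theorem measurableSet_rect (lam : EuclideanSpace ℝ (Fin n) → ℝ) (z₀ : GPt n m) (r : ℝ) :
    MeasurableSet (rect lam z₀ r) :=
  (rectDomain lam z₀ r).isOpen.measurableSet

/-- A linear functional along an absolutely continuous curve grows at most at the rate which
bounds it on the velocities. -/
theorem apply_sub_le_of_absolutelyContinuous {V : Type*} [NormedAddCommGroup V] [NormedSpace ℝ V]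
    [FiniteDimensional ℝ V] {γ : ℝ → V} {T : ℝ} (hT : 0 ≤ T)
    (hγ : AbsolutelyContinuousOnInterval γ 0 T) (ℓ : V →L[ℝ] ℝ) (M : ℝ)
    (hM : ∀ᵐ t ∂(volume.restrict (Icc 0 T)), ℓ (deriv γ t) ≤ M) :
    ℓ (γ T - γ 0) ≤ T * M := by
  have hac : AbsolutelyContinuousOnInterval (fun t => ℓ (γ t)) 0 T := by
    have h0 := Filter.Tendsto.const_mul ‖ℓ‖ hγ
    rw [mul_zero] at h0
    refine squeeze_zero (fun E => Finset.sum_nonneg fun _ _ => dist_nonneg) (fun E => ?_) h0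
    rw [Finset.mul_sum]
    exact Finset.sum_le_sum fun i _ => ℓ.lipschitz.dist_le_mul _ _
  -- Differentiability of the curve itself is needed to identify the derivative of `ℓ ∘ γ` with `ℓ
  -- (γ')`. It holds almost everywhere by bounded variation.
  have hdiff := hγ.boundedVariationOn.ae_differentiableAt_of_mem_uIcc
  have hI := hac.integral_deriv_eq_sub
  rw [map_sub, ← hI]
  have : T * M = ∫ _ in (0 : ℝ)..T, M := by simp
  rw [this]
  refine intervalIntegral.integral_mono_ae_restrict hT hac.intervalIntegrable_deriv
    intervalIntegrable_const ?_
  have h3 : ∀ᵐ t ∂(volume.restrict (Icc 0 T)), DifferentiableAt ℝ γ t := by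
    rw [ae_restrict_iff' measurableSet_Icc]
    rwa [uIcc_of_le hT] at hdiff
  filter_upwards [hM, h3] with t h1 h2
  have : deriv (fun t => ℓ (γ t)) t = ℓ (deriv γ t) :=
    (ℓ.hasFDerivAt.comp_hasDerivAt t h2.hasDerivAt).deriv
  rwa [this]

/-- The subunit condition with `η = 0` says `|γ_x'| ≤ 1`. Pairing the velocity with the total
displacement `d` gives `‖d‖² ≤ T ‖d‖`. -/
theorem IsSubunit.norm_fst_sub_le {lam : EuclideanSpace ℝ (Fin n) → ℝ} {T : ℝ} (hT : 0 ≤ T)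
    {γ : ℝ → GPt n m} (hγ : IsSubunit lam T γ) : ‖(γ T).1 - (γ 0).1‖ ≤ T := by
  set d := (γ T).1 - (γ 0).1 with hd
  have h := apply_sub_le_of_absolutelyContinuous hT hγ.1
    ((innerSL ℝ d).comp (ContinuousLinearMap.fst ℝ _ _)) ‖d‖ (by
      filter_upwards [hγ.2] with t ht
      have := ht d 0
      simp only [inner_zero_right, add_zero, norm_zero] at this
      simp only [ContinuousLinearMap.comp_apply, ContinuousLinearMap.coe_fst', innerSL_apply_apply]
      rw [real_inner_comm]
      refine (abs_le_of_sq_le_sq' ?_ (norm_nonneg d)).2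
      linarith)
  simp only [ContinuousLinearMap.comp_apply, ContinuousLinearMap.coe_fst', innerSL_apply_apply,
    Prod.fst_sub, ← hd, real_inner_self_eq_norm_sq] at h
  by_contra hlt
  push Not at hlt
  nlinarith [norm_nonneg d]

/-- The subunit condition with `ξ = 0` says `|γ_y'| ≤ λ(γ_x)`, so the vertical speed is at most the
largest value of `λ` met on the way. -/
theorem IsSubunit.norm_snd_sub_le {lam : EuclideanSpace ℝ (Fin n) → ℝ} {T M : ℝ} (hT : 0 ≤ T)
    {γ : ℝ → GPt n m} (hγ : IsSubunit lam T γ) (hlam : ∀ t ∈ Icc 0 T, |lam (γ t).1| ≤ M)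
    : ‖(γ T).2 - (γ 0).2‖ ≤ T * M := by
  set d := (γ T).2 - (γ 0).2 with hd
  have hM : 0 ≤ M := (abs_nonneg _).trans (hlam 0 ⟨le_rfl, hT⟩)
  have h := apply_sub_le_of_absolutelyContinuous hT hγ.1
    ((innerSL ℝ d).comp (ContinuousLinearMap.snd ℝ _ _)) (M * ‖d‖) (by
      filter_upwards [hγ.2, ae_restrict_mem measurableSet_Icc] with t ht htT
      have := ht 0 d
      simp only [inner_zero_right, zero_add, norm_zero] at this
      simp only [ContinuousLinearMap.comp_apply, ContinuousLinearMap.coe_snd', innerSL_apply_apply]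
      rw [real_inner_comm]
      refine (abs_le_of_sq_le_sq' ?_ (by positivity)).2
      have h2 : lam (γ t).1 ^ 2 ≤ M ^ 2 := by
        rw [← sq_abs]; exact pow_le_pow_left₀ (abs_nonneg _) (hlam t htT) 2
      rw [mul_pow]
      nlinarith [sq_nonneg ‖d‖])
  simp only [ContinuousLinearMap.comp_apply, ContinuousLinearMap.coe_snd', innerSL_apply_apply,
    Prod.snd_sub, ← hd, real_inner_self_eq_norm_sq] at h
  by_contra hlt
  push Not at hlt
  have : 0 ≤ T * M := by positivity
  nlinarith [norm_nonneg d]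

theorem IsSubunit.mono {lam : EuclideanSpace ℝ (Fin n) → ℝ} {T S : ℝ} {γ : ℝ → GPt n m}
    (hγ : IsSubunit lam T γ) (hS : 0 ≤ S) (hST : S ≤ T) : IsSubunit lam S γ := by
  refine ⟨hγ.1.mono ?_, ?_⟩
  · rw [uIcc_of_le hS, uIcc_of_le (hS.trans hST)]
    exact Icc_subset_Icc_right hST
  · exact ae_restrict_of_ae_restrict_of_subset (Icc_subset_Icc_right hST) hγ.2

theorem rhoBall_subset_rect (hn : 1 ≤ n) {lam : EuclideanSpace ℝ (Fin n) → ℝ}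
    (hl : IsAdmissible lam) (z₀ : GPt n m) (r : ℝ) : rhoBall lam z₀ r ⊆ rect lam z₀ r := by
  intro w hw
  simp only [rhoBall, rho, mem_ofPred_eq, iInf_lt_iff] at hw
  obtain ⟨T, ⟨γ, hγ, h0, hT⟩, hTr⟩ := hw
  have hTr' : (T : ℝ) < r := by
    rw [ENNReal.ofReal, ENNReal.coe_lt_coe] at hTr
    exact Real.lt_toNNReal_iff_coe_lt.1 hTr
  have hr : 0 < r := T.2.trans_lt hTr'
  -- The whole curve, not only its endpoint, stays over the Euclidean ball, so `λ ≤ Λ(z₀, r)` along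
  -- it.
  have hx : ∀ t ∈ Icc 0 (T : ℝ), ‖(γ t).1 - z₀.1‖ < r := fun t ht => by
    rw [← h0]
    exact ((hγ.mono ht.1 ht.2).norm_fst_sub_le ht.1).trans_lt (ht.2.trans_lt hTr')
  refine ⟨by simpa [hT] using hx T ⟨T.coe_nonneg, le_rfl⟩, ?_⟩
  have := hγ.norm_snd_sub_le T.coe_nonneg (M := Lam lam z₀ r) (fun t ht => by
    rw [abs_of_nonneg (hl.nonneg _)]; exact le_Lam hl.continuous (hx t ht))
  rw [hT, h0] at this
  exact this.trans_lt (mul_lt_mul_of_pos_right hTr' (Lam_pos hn hl z₀ hr))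

/-- The ramp that rises from `0` to `1` on `[0, 1]`. -/
def ramp (s : ℝ) : ℝ := max 0 (min 1 s)

theorem ramp_nonneg (s : ℝ) : 0 ≤ ramp s := le_max_left _ _

theorem ramp_le_one (s : ℝ) : ramp s ≤ 1 := max_le zero_le_one (min_le_left _ _)

theorem ramp_of_nonpos {s : ℝ} (h : s ≤ 0) : ramp s = 0 := max_eq_left ((min_le_right _ _).trans h)

theorem ramp_of_one_le {s : ℝ} (h : 1 ≤ s) : ramp s = 1 := by simp [ramp, h]

theorem ramp_of_mem {s : ℝ} (h0 : 0 ≤ s) (h1 : s ≤ 1) : ramp s = s := by simp [ramp, h0, h1]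

theorem lipschitzWith_ramp : LipschitzWith 1 ramp :=
  (LipschitzWith.id.const_min 1).const_max 0

theorem hasDerivAt_ramp_of_neg {s : ℝ} (h : s < 0) : HasDerivAt ramp 0 s :=
  (hasDerivAt_const s (0 : ℝ)).congr_of_eventuallyEq
    ((eventually_lt_nhds h).mono fun _ ht => ramp_of_nonpos ht.le)

theorem hasDerivAt_ramp_of_one_lt {s : ℝ} (h : 1 < s) : HasDerivAt ramp 0 s :=
  (hasDerivAt_const s (1 : ℝ)).congr_of_eventuallyEq
    ((eventually_gt_nhds h).mono fun _ ht => ramp_of_one_le ht.le)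

theorem hasDerivAt_ramp_of_mem {s : ℝ} (h0 : 0 < s) (h1 : s < 1) : HasDerivAt ramp 1 s :=
  (hasDerivAt_id s).congr_of_eventuallyEq
    (((eventually_gt_nhds h0).and (eventually_lt_nhds h1)).mono
      fun _ ht => ramp_of_mem ht.1.le ht.2.le)

theorem hasDerivAt_ramp_comp {a b t e : ℝ} (h : HasDerivAt ramp e ((t - a) / b)) :
    HasDerivAt (fun s => ramp ((s - a) / b)) (e / b) t := by
  have h2 : HasDerivAt (fun s : ℝ => (s - a) / b) (1 / b) t :=
    ((hasDerivAt_id t).sub_const a).div_const b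
  have := h.comp t h2
  rwa [mul_one_div] at this

theorem lipschitzWith_ramp_comp (a b : ℝ) :
    LipschitzWith (Real.toNNReal |b⁻¹|) (fun s => ramp ((s - a) / b)) := by
  refine LipschitzWith.of_dist_le_mul fun s t => ?_
  rw [Real.coe_toNNReal _ (abs_nonneg _)]
  refine (lipschitzWith_ramp.dist_le_mul _ _).trans_eq ?_
  rw [Real.dist_eq, Real.dist_eq, ← sub_div, ← abs_mul]
  simp only [NNReal.coe_one, one_mul]
  congr 1
  ring

/-- Vertical motion is cheap only where `λ` is comparable with `Λ`. The curve goes horizontally to a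
point `x` with `λ(x) > Λ/2`, rises there, and returns horizontally. The three legs take times `r`,
`2r`, `2r`. The constant `6` leaves room for the strict inequality in the definition of the ball. -/
theorem rect_subset_rhoBall {lam : EuclideanSpace ℝ (Fin n) → ℝ} (z₀ : GPt n m) {r : ℝ} (hr : 0 < r) :
    rect lam z₀ r ⊆ rhoBall lam z₀ (6 * r) := by
  rintro w ⟨hw1, hw2⟩
  -- A non-empty rectangle forces `Λ > 0`, because its second condition is strict.
  have hL : 0 < Lam lam z₀ r := by
    by_contra h
    push Not at h
    have := mul_nonpos_of_nonneg_of_nonpos hr.le h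
    linarith [norm_nonneg (w.2 - z₀.2)]
  obtain ⟨-, ⟨x, hx, rfl⟩, hxL⟩ := exists_lt_of_lt_csSup
    ((Metric.nonempty_ball.2 hr).image lam) (half_lt_self hL)
  have hxr : ‖x - z₀.1‖ < r := by simpa [dist_eq_norm] using hx
  have hwx : ‖w.1 - x‖ ≤ 2 * r := by
    calc ‖w.1 - x‖ = ‖(w.1 - z₀.1) - (x - z₀.1)‖ := by congr 1; abel
      _ ≤ ‖w.1 - z₀.1‖ + ‖x - z₀.1‖ := norm_sub_le _ _
      _ ≤ 2 * r := by linarith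
  -- The ramps run on `[0, r]`, `[r, 3r]` and `[3r, 5r]`, so only one of them moves at a time.
  set φ₁ : ℝ → ℝ := fun t => ramp ((t - 0) / r) with hφ₁
  set φ₂ : ℝ → ℝ := fun t => ramp ((t - r) / (2 * r)) with hφ₂
  set φ₃ : ℝ → ℝ := fun t => ramp ((t - 3 * r) / (2 * r)) with hφ₃
  let γ : ℝ → GPt n m := fun t =>
    (z₀.1 + φ₁ t • (x - z₀.1) + φ₃ t • (w.1 - x), z₀.2 + φ₂ t • (w.2 - z₀.2))
  have hder : ∀ t e₁ e₂ e₃ : ℝ, HasDerivAt ramp e₁ ((t - 0) / r) →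
      HasDerivAt ramp e₂ ((t - r) / (2 * r)) → HasDerivAt ramp e₃ ((t - 3 * r) / (2 * r)) →
      deriv γ t = ((e₁ / r) • (x - z₀.1) + (e₃ / (2 * r)) • (w.1 - x),
        (e₂ / (2 * r)) • (w.2 - z₀.2)) := by
    intro t e₁ e₂ e₃ h1 h2 h3
    exact ((((hasDerivAt_ramp_comp h1).smul_const (x - z₀.1)).const_add z₀.1).add
      ((hasDerivAt_ramp_comp h3).smul_const (w.1 - x))).prodMk
      (((hasDerivAt_ramp_comp h2).smul_const (w.2 - z₀.2)).const_add z₀.2) |>.deriv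
  have hxcase : ∀ (c : ℝ) (d : EuclideanSpace ℝ (Fin n)), |c| * ‖d‖ ≤ 1 → ∀ l : ℝ,
      ∀ (ξ : EuclideanSpace ℝ (Fin n)) (η : EuclideanSpace ℝ (Fin m)),
      (inner ℝ (c • d) ξ + inner ℝ (0 : EuclideanSpace ℝ (Fin m)) η) ^ 2 ≤
        ‖ξ‖ ^ 2 + l ^ 2 * ‖η‖ ^ 2 := by
    intro c d hcd l ξ η
    rw [inner_zero_left, add_zero]
    have h1 : |inner ℝ (c • d) ξ| ≤ ‖ξ‖ := by
      refine (abs_real_inner_le_norm _ _).trans ?_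
      rw [norm_smul, Real.norm_eq_abs]
      exact mul_le_of_le_one_left (norm_nonneg _) hcd
    have h2 : inner ℝ (c • d) ξ ^ 2 ≤ ‖ξ‖ ^ 2 := by
      rw [← sq_abs]; exact pow_le_pow_left₀ (abs_nonneg _) h1 2
    nlinarith [sq_nonneg (l * ‖η‖)]
  have hsub : IsSubunit lam (5 * r) γ := by
    constructor
    · have hlip : ∀ (a b : ℝ) {E : Type} [NormedAddCommGroup E] [NormedSpace ℝ E] (e : E),
          ∃ K : ℝ≥0, LipschitzWith K (fun t : ℝ => ramp ((t - a) / b) • e) := by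
        intro a b E _ _ e
        refine ⟨‖e‖₊ * Real.toNNReal |b⁻¹|, LipschitzWith.of_dist_le_mul fun s t => ?_⟩
        rw [dist_eq_norm, ← sub_smul, norm_smul, mul_comm, NNReal.coe_mul, mul_assoc, coe_nnnorm]
        exact mul_le_mul_of_nonneg_left ((lipschitzWith_ramp_comp a b).dist_le_mul s t)
          (norm_nonneg _)
      obtain ⟨K₁, h1⟩ := hlip 0 r (x - z₀.1)
      obtain ⟨K₂, h2⟩ := hlip r (2 * r) (w.2 - z₀.2)
      obtain ⟨K₃, h3⟩ := hlip (3 * r) (2 * r) (w.1 - x)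
      have := ((((LipschitzWith.const z₀.1).add h1).add h3).prodMk
        ((LipschitzWith.const z₀.2).add h2))
      exact (this.lipschitzOnWith (s := uIcc 0 (5 * r))).absolutelyContinuousOnInterval
    · have hne : ∀ a : ℝ, ∀ᵐ t : ℝ, t ≠ a := fun a => by
        simp [ae_iff]
      rw [ae_restrict_iff' measurableSet_Icc]
      -- The corners of the ramps are discarded. At every other time each ramp is differentiable,
      -- with slope `0` or `1`.
      filter_upwards [hne 0, hne r, hne (3 * r), hne (5 * r)] with t h0 h1 h2 h3 ht
      have ht0 : 0 < t := lt_of_le_of_ne ht.1 (Ne.symm h0)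
      have ht5 : t < 5 * r := lt_of_le_of_ne ht.2 h3
      rcases lt_or_gt_of_ne h1 with hlt | hgt
      · rw [hder t 1 0 0 (hasDerivAt_ramp_of_mem (by simpa using by positivity)
          (by rw [div_lt_one hr]; linarith))
          (hasDerivAt_ramp_of_neg (div_neg_of_neg_of_pos (by linarith) (by linarith)))
          (hasDerivAt_ramp_of_neg (div_neg_of_neg_of_pos (by linarith) (by linarith)))]
        simp only [zero_div, zero_smul, add_zero]
        refine hxcase _ _ ?_ _
        rw [abs_of_pos (by positivity), one_div, inv_mul_le_iff₀ hr]
        linarith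
      · rcases lt_or_gt_of_ne h2 with hlt' | hgt'
        · rw [hder t 0 1 0 (hasDerivAt_ramp_of_one_lt (by rw [lt_div_iff₀ hr]; linarith))
            (hasDerivAt_ramp_of_mem (div_pos (by linarith) (by linarith))
              (by rw [div_lt_one (by linarith)]; linarith))
            (hasDerivAt_ramp_of_neg (div_neg_of_neg_of_pos (by linarith) (by linarith)))]
          have hγx : (γ t).1 = x := by
            have e1 : φ₁ t = 1 := ramp_of_one_le (by rw [le_div_iff₀ hr]; linarith)
            have e3 : φ₃ t = 0 := ramp_of_nonpos
              (div_nonpos_of_nonpos_of_nonneg (by linarith) (by linarith))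
            simp only [γ, e1, e3]
            simp
          rw [hγx]
          simp only [zero_div, zero_smul, add_zero, inner_zero_left, zero_add]
          intro ξ η
          have h1 : |inner ℝ ((1 / (2 * r)) • (w.2 - z₀.2)) η| ≤ lam x * ‖η‖ := by
            refine (abs_real_inner_le_norm _ _).trans ?_
            rw [norm_smul, Real.norm_eq_abs, abs_of_pos (by positivity)]
            refine mul_le_mul_of_nonneg_right ?_ (norm_nonneg _)
            rw [one_div, inv_mul_le_iff₀ (by positivity)]
            have : r * Lam lam z₀ r ≤ 2 * r * lam x := by
              have : sSup (lam '' Metric.ball z₀.1 r) = Lam lam z₀ r := rfl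
              nlinarith
            linarith
          have h2 := pow_le_pow_left₀ (abs_nonneg _) h1 2
          rw [sq_abs, mul_pow] at h2
          nlinarith [sq_nonneg ‖ξ‖]
        · rw [hder t 0 0 1 (hasDerivAt_ramp_of_one_lt (by rw [lt_div_iff₀ hr]; linarith))
            (hasDerivAt_ramp_of_one_lt (by rw [lt_div_iff₀ (by linarith)]; linarith))
            (hasDerivAt_ramp_of_mem (div_pos (by linarith) (by linarith))
              (by rw [div_lt_one (by linarith)]; linarith))]
          simp only [zero_div, zero_smul, zero_add]
          refine hxcase _ _ ?_ _
          rw [abs_of_pos (by positivity), one_div, inv_mul_le_iff₀ (by positivity)]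
          linarith
  have h0 : γ 0 = z₀ := by
    have e1 : φ₁ 0 = 0 := ramp_of_nonpos (by simp)
    have e2 : φ₂ 0 = 0 := ramp_of_nonpos
      (div_nonpos_of_nonpos_of_nonneg (by linarith) (by linarith))
    have e3 : φ₃ 0 = 0 := ramp_of_nonpos
      (div_nonpos_of_nonpos_of_nonneg (by linarith) (by linarith))
    simp only [γ, e1, e2, e3]
    simp
  have h5 : γ (5 * r) = w := by
    have e1 : φ₁ (5 * r) = 1 := ramp_of_one_le (by rw [le_div_iff₀ hr]; linarith)
    have e2 : φ₂ (5 * r) = 1 := ramp_of_one_le (by rw [le_div_iff₀ (by linarith)]; linarith)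
    have e3 : φ₃ (5 * r) = 1 := ramp_of_one_le (by rw [le_div_iff₀ (by linarith)]; linarith)
    simp only [γ, e1, e2, e3]
    simp
  have h5r : ((Real.toNNReal (5 * r) : ℝ≥0) : ℝ) = 5 * r := Real.coe_toNNReal _ (by linarith)
  have hle : rho lam z₀ w ≤ ENNReal.ofReal (5 * r) :=
    iInf₂_le (Real.toNNReal (5 * r)) ⟨γ, by rw [h5r]; exact hsub, h0, by rw [h5r]; exact h5⟩
  exact hle.trans_lt ((ENNReal.ofReal_lt_ofReal_iff (by linarith)).2 (by linarith))

/-! ### The weighted measures of rectangles -/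

theorem weightMeasure_lt_top {w : GPt n m → ℝ} (hw : IsWeight w) {S : Set (GPt n m)}
    (hS : Bornology.IsBounded S) : weightMeasure w S < ∞ := by
  have hK : IsCompact (closure S) := hS.isCompact_closure
  refine (measure_mono subset_closure).trans_lt ?_
  have hi := (hw.locallyIntegrable.integrableOn_isCompact hK)
  have : IsFiniteMeasure ((volume.restrict (closure S)).withDensity fun z => ENNReal.ofReal (w z)) :=
    isFiniteMeasure_withDensity_ofReal hi.2
  rw [← restrict_withDensity hK.measurableSet] at this
  have h := this.measure_univ_lt_top
  rwa [Measure.restrict_apply_univ] at h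

theorem weightMeasure_rect_lt_top {w : GPt n m → ℝ} (hw : IsWeight w)
    (lam : EuclideanSpace ℝ (Fin n) → ℝ) (z₀ : GPt n m) (r : ℝ) :
    weightMeasure w (rect lam z₀ r) < ∞ :=
  weightMeasure_lt_top hw (rectDomain lam z₀ r).isBounded

theorem WeightDoubling.pow {lam : EuclideanSpace ℝ (Fin n) → ℝ} {w : GPt n m → ℝ} {C : ℝ}
    (hd : WeightDoubling lam w C) (z : GPt n m) {r : ℝ} (hr : 0 < r) (k : ℕ) :
    weightMeasure w (rhoBall lam z (2 ^ k * r)) ≤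
      ENNReal.ofReal C ^ k * weightMeasure w (rhoBall lam z r) := by
  induction k with
  | zero => simp
  | succ k ih =>
    have h1 := hd z (2 ^ k * r) (by positivity)
    rw [pow_succ', mul_assoc, pow_succ', mul_assoc]
    exact h1.trans (mul_le_mul_right ih _)

/-- The vertical half-sides grow at least like `2^k r Λ(z₀, r)`, since `Λ` is non-decreasing in the
radius and positive. -/
theorem iUnion_rect (hn : 1 ≤ n) {lam : EuclideanSpace ℝ (Fin n) → ℝ} (hl : IsAdmissible lam)
    (z₀ : GPt n m) {r : ℝ} (hr : 0 < r) : ⋃ k : ℕ, rect lam z₀ (2 ^ k * r) = univ := by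
  refine eq_univ_of_forall fun z => mem_iUnion.2 ?_
  have hL := Lam_pos hn hl z₀ hr
  have ht : Tendsto (fun k : ℕ => (2 : ℝ) ^ k * r) atTop atTop :=
    (tendsto_pow_atTop_atTop_of_one_lt one_lt_two).atTop_mul_const hr
  obtain ⟨k, h1, h2, h3⟩ := ((ht.eventually_gt_atTop ‖z.1 - z₀.1‖).and
    (((ht.atTop_mul_const hL).eventually_gt_atTop ‖z.2 - z₀.2‖).and
      (ht.eventually_ge_atTop r))).exists
  refine ⟨k, h1, h2.trans_le ?_⟩
  exact mul_le_mul_of_nonneg_left (Lam_mono hl.continuous hr h3) (by positivity)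

/-- A rectangle of measure zero contains a metric ball of measure zero. Doubling then kills all its
dyadic dilates, and these exhaust the space, against the non-triviality of the weight. -/
theorem weightMeasure_rect_pos (hn : 1 ≤ n) {lam : EuclideanSpace ℝ (Fin n) → ℝ}
    (hl : IsAdmissible lam) {w : GPt n m → ℝ} (hw : IsWeight w) {C : ℝ}
    (hd : WeightDoubling lam w C) (z₀ : GPt n m) {r : ℝ} (hr : 0 < r) :
    0 < weightMeasure w (rect lam z₀ r) := by
  by_contra h0
  have h0 : weightMeasure w (rect lam z₀ r) = 0 := by simpa using h0
  have hB : weightMeasure w (rhoBall lam z₀ r) = 0 :=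
    measure_mono_null (rhoBall_subset_rect hn hl z₀ r) h0
  have hk : ∀ k : ℕ, weightMeasure w (rect lam z₀ (2 ^ k * (r / 6))) = 0 := by
    intro k
    refine measure_mono_null (rect_subset_rhoBall z₀ (by positivity)) ?_
    have := hd.pow z₀ hr k
    rw [hB, mul_zero] at this
    rw [show 6 * (2 ^ k * (r / 6)) = 2 ^ k * r by ring]
    exact le_antisymm this (zero_le)
  have huniv : weightMeasure w univ = 0 := by
    rw [← iUnion_rect hn hl z₀ (r := r / 6) (by positivity)]
    exact measure_iUnion_null hk
  rw [Measure.measure_univ_eq_zero, weightMeasure, withDensity_eq_zero_iff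
    hw.locallyIntegrable.aestronglyMeasurable.aemeasurable.ennreal_ofReal] at huniv
  refine hw.nontrivial ?_
  filter_upwards [huniv] with z hz
  exact le_antisymm (ENNReal.ofReal_eq_zero.1 hz) (hw.nonneg z)

/-- Three doublings reach from `B(z₀, r) ⊆ Q(z₀, r)` to `B(z₀, 8r)`. The factor `8` is the first
power of two above the `6` of `rect_subset_rhoBall`. -/
theorem weightMeasure_rhoBall_le (hn : 1 ≤ n) {lam : EuclideanSpace ℝ (Fin n) → ℝ}
    (hl : IsAdmissible lam) {w : GPt n m → ℝ} {C : ℝ}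
    (hd : WeightDoubling lam w C) (z₀ : GPt n m) {r : ℝ} (hr : 0 < r) :
    weightMeasure w (rhoBall lam z₀ (8 * r)) ≤
      ENNReal.ofReal C ^ 3 * weightMeasure w (rect lam z₀ r) := by
  have h := hd.pow z₀ hr 3
  norm_num at h
  exact h.trans (mul_le_mul_right (measure_mono (rhoBall_subset_rect hn hl z₀ r)) _)

theorem rect_subset_rhoBall_eight {lam : EuclideanSpace ℝ (Fin n) → ℝ} (z₀ : GPt n m) {r : ℝ}
    (hr : 0 < r) : rect lam z₀ r ⊆ rhoBall lam z₀ (8 * r) :=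
  (rect_subset_rhoBall z₀ hr).trans fun _ hw =>
    lt_of_lt_of_le hw (ENNReal.ofReal_le_ofReal (by linarith))

/-- The two ellipticity bounds are compared on a horizontal unit vector, where the degenerate form
equals `1`. This makes `μ(Q) ≥ 1`, which later absorbs lower-order terms. -/
theorem v_le_u (hn : 1 ≤ n) (D : Operator n m) : ∀ᵐ z, D.v z ≤ D.u z := by
  filter_upwards [D.ellipticity] with z hz
  have h := hz (Pi.single (Sum.inl ⟨0, hn⟩) 1)
  have e : grushinForm D.lam z (Pi.single (Sum.inl (⟨0, hn⟩ : Fin n)) 1) = 1 := by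
    simp [grushinForm, Pi.single_apply]
  rw [e] at h
  linarith [h.1.trans h.2]

theorem weightMeasure_v_le (hn : 1 ≤ n) (D : Operator n m) :
    weightMeasure D.v ≤ weightMeasure D.u :=
  withDensity_mono ((v_le_u hn D).mono fun _ hz => ENNReal.ofReal_le_ofReal hz)

/-! ### Cutoff functions -/

/-- A cutoff function, equal to `1` on the box with half-sides `a`, `a * Λ` and to `0` outside
the box with half-sides `b`, `b * Λ`. -/
def cutoff (z₀ : GPt n m) (Λ a b : ℝ) (z : GPt n m) : ℝ :=
  1 - ramp ((max ‖z.1 - z₀.1‖ (Λ⁻¹ * ‖z.2 - z₀.2‖) - a) / (b - a))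

/-- The closed box which contains the support of `cutoff z₀ Λ a b`. -/
def closedBox (z₀ : GPt n m) (Λ b : ℝ) : Set (GPt n m) :=
  Metric.closedBall z₀.1 b ×ˢ Metric.closedBall z₀.2 (b * Λ)

theorem isCompact_closedBox (z₀ : GPt n m) (Λ b : ℝ) : IsCompact (closedBox z₀ Λ b) :=
  (isCompact_closedBall _ _).prod (isCompact_closedBall _ _)

theorem cutoff_nonneg (z₀ : GPt n m) (Λ a b : ℝ) (z : GPt n m) : 0 ≤ cutoff z₀ Λ a b z :=
  sub_nonneg.2 (ramp_le_one _)

theorem cutoff_le_one (z₀ : GPt n m) (Λ a b : ℝ) (z : GPt n m) : cutoff z₀ Λ a b z ≤ 1 :=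
  sub_le_self _ (ramp_nonneg _)

theorem cutoff_eq_one {z₀ : GPt n m} {Λ a b : ℝ} (hΛ : 0 < Λ) (hab : a < b) {z : GPt n m}
    (h1 : ‖z.1 - z₀.1‖ ≤ a) (h2 : ‖z.2 - z₀.2‖ ≤ a * Λ) : cutoff z₀ Λ a b z = 1 := by
  rw [cutoff, ramp_of_nonpos, sub_zero]
  refine div_nonpos_of_nonpos_of_nonneg (sub_nonpos.2 (max_le h1 ?_)) (by linarith)
  rw [inv_mul_le_iff₀ hΛ]
  linarith

theorem cutoff_eq_zero {z₀ : GPt n m} {Λ a b : ℝ} (hΛ : 0 < Λ) (hab : a < b) {z : GPt n m}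
    (hz : z ∉ closedBox z₀ Λ b) : cutoff z₀ Λ a b z = 0 := by
  rw [cutoff, ramp_of_one_le, sub_self]
  rw [le_div_iff₀ (by linarith), one_mul]
  refine sub_le_sub_right ?_ a
  by_contra hlt
  rw [not_le, max_lt_iff, inv_mul_lt_iff₀ hΛ] at hlt
  refine hz ⟨?_, ?_⟩
  · simpa [dist_eq_norm] using hlt.1.le
  · simpa [dist_eq_norm, mul_comm] using hlt.2.le

/-- The distance is anisotropic: vertical increments count with weight `Λ⁻¹`. The factor `λ ≤ Λ` in
`∇_λ` cancels exactly this weight, which leaves a gradient bound independent of `Λ`. -/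
theorem abs_cutoff_sub_le {z₀ : GPt n m} {Λ a b : ℝ} (hΛ : 0 < Λ) (hab : a < b) (z w : GPt n m) :
    |cutoff z₀ Λ a b z - cutoff z₀ Λ a b w| ≤
      (b - a)⁻¹ * max ‖z.1 - w.1‖ (Λ⁻¹ * ‖z.2 - w.2‖) := by
  have h1 : |cutoff z₀ Λ a b z - cutoff z₀ Λ a b w| ≤
      (b - a)⁻¹ * |max ‖z.1 - z₀.1‖ (Λ⁻¹ * ‖z.2 - z₀.2‖) -
        max ‖w.1 - z₀.1‖ (Λ⁻¹ * ‖w.2 - z₀.2‖)| := by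
    have h := (lipschitzWith_ramp_comp a (b - a)).dist_le_mul
      (max ‖z.1 - z₀.1‖ (Λ⁻¹ * ‖z.2 - z₀.2‖)) (max ‖w.1 - z₀.1‖ (Λ⁻¹ * ‖w.2 - z₀.2‖))
    rw [Real.coe_toNNReal _ (abs_nonneg _), abs_of_pos (inv_pos.2 (by linarith)),
      Real.dist_eq, Real.dist_eq] at h
    rw [cutoff, cutoff, sub_sub_sub_cancel_left, abs_sub_comm]
    exact h
  refine h1.trans (mul_le_mul_of_nonneg_left ?_ (inv_nonneg.2 (by linarith)))
  refine (abs_max_sub_max_le_max _ _ _ _).trans (max_le_max ?_ ?_)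
  · refine (abs_norm_sub_norm_le _ _).trans_eq ?_
    congr 1; abel
  · rw [← mul_sub, abs_mul, abs_of_pos (inv_pos.2 hΛ)]
    refine mul_le_mul_of_nonneg_left ((abs_norm_sub_norm_le _ _).trans_eq ?_) (inv_pos.2 hΛ).le
    congr 1; abel

theorem lipschitzWith_cutoff {z₀ : GPt n m} {Λ a b : ℝ} (hΛ : 0 < Λ) (hab : a < b) :
    ∃ K, LipschitzWith K (cutoff z₀ Λ a b) := by
  have hb : 0 < (b - a)⁻¹ := inv_pos.2 (by linarith)
  refine ⟨Real.toNNReal ((b - a)⁻¹ * max 1 Λ⁻¹), LipschitzWith.of_dist_le_mul fun z w => ?_⟩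
  rw [Real.coe_toNNReal _ (by positivity), Real.dist_eq, mul_assoc]
  refine (abs_cutoff_sub_le hΛ hab z w).trans (mul_le_mul_of_nonneg_left ?_ hb.le)
  have e1 : ‖z.1 - w.1‖ ≤ dist z w := by rw [dist_eq_norm]; exact norm_fst_le (z - w)
  have e2 : ‖z.2 - w.2‖ ≤ dist z w := by rw [dist_eq_norm]; exact norm_snd_le (z - w)
  refine max_le (e1.trans ?_) ?_
  · exact le_mul_of_one_le_left dist_nonneg (le_max_left _ _)
  · exact mul_le_mul (le_max_right _ _) e2 (norm_nonneg _) (by positivity)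

/-- The bound needs no differentiability, because `fderiv` takes the value `0` at points where the
function is not differentiable. -/
theorem abs_pderiv_le {g : GPt n m → ℝ} {i : Fin n ⊕ Fin m} {L : ℝ} (hL : 0 ≤ L) {z : GPt n m}
    (h : ∀ t : ℝ, |g (z + t • basisVec i) - g z| ≤ L * |t|) : |pderiv i g z| ≤ L := by
  by_cases hd : DifferentiableAt ℝ g z
  · have h1 : HasDerivAt (fun t : ℝ => g (z + t • basisVec i)) (pderiv i g z) 0 := by
      have h2 : HasDerivAt (fun t : ℝ => z + t • (basisVec i : GPt n m)) (basisVec i) 0 := by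
        simpa using ((hasDerivAt_id (0 : ℝ)).smul_const (basisVec i : GPt n m)).const_add z
      have h3 : HasFDerivAt g (fderiv ℝ g z) (z + (0 : ℝ) • basisVec i) := by
        simpa using hd.hasFDerivAt
      exact h3.comp_hasDerivAt 0 h2
    simpa using h1.le_of_lip' hL (Eventually.of_forall fun t => by simpa using h t)
  · rw [pderiv, fderiv_zero_of_not_differentiableAt hd]
    simpa using hL

theorem abs_pderiv_cutoff_inl_le {z₀ : GPt n m} {Λ a b : ℝ} (hΛ : 0 < Λ) (hab : a < b) (i : Fin n)
    (z : GPt n m) : |pderiv (Sum.inl i) (cutoff z₀ Λ a b) z| ≤ (b - a)⁻¹ := by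
  refine abs_pderiv_le (inv_nonneg.2 (by linarith)) fun t => ?_
  refine (abs_cutoff_sub_le hΛ hab _ _).trans_eq ?_
  simp [basisVec, norm_smul]

theorem abs_pderiv_cutoff_inr_le {z₀ : GPt n m} {Λ a b : ℝ} (hΛ : 0 < Λ) (hab : a < b) (j : Fin m)
    (z : GPt n m) : |pderiv (Sum.inr j) (cutoff z₀ Λ a b) z| ≤ (b - a)⁻¹ * Λ⁻¹ := by
  refine abs_pderiv_le (mul_nonneg (inv_nonneg.2 (by linarith)) (inv_nonneg.2 hΛ.le)) fun t => ?_
  refine (abs_cutoff_sub_le hΛ hab _ _).trans_eq ?_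
  simp only [basisVec, Prod.fst_add, Prod.smul_fst, smul_zero, add_zero, sub_self, norm_zero,
    Prod.snd_add, Prod.smul_snd, add_sub_cancel_left, norm_smul, Real.norm_eq_abs,
    PiLp.norm_single, norm_one, mul_one]
  rw [max_eq_right (by positivity), mul_assoc]

theorem pderiv_eq_zero_of_notMem {g : GPt n m → ℝ} {K : Set (GPt n m)} (hK : IsClosed K)
    (hg : ∀ z ∉ K, g z = 0) (i : Fin n ⊕ Fin m) {z : GPt n m} (hz : z ∉ K) :
    pderiv i g z = 0 := by
  have : g =ᶠ[𝓝 z] fun _ => (0 : ℝ) := by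
    filter_upwards [hK.isOpen_compl.mem_nhds hz] with w hw using hg w hw
  rw [pderiv, this.fderiv_eq]
  simp

theorem gradSq_cutoff_le {lam : EuclideanSpace ℝ (Fin n) → ℝ} {z₀ : GPt n m} {Λ a b : ℝ}
    (hΛ : 0 < Λ) (hab : a < b) {z : GPt n m} (h0 : 0 ≤ lam z.1) (h1 : lam z.1 ≤ Λ) :
    gradSq lam (cutoff z₀ Λ a b) z ≤ (n + m) * ((b - a)⁻¹) ^ 2 := by
  have hx : ∀ i : Fin n, pderiv (Sum.inl i) (cutoff z₀ Λ a b) z ^ 2 ≤ ((b - a)⁻¹) ^ 2 := fun i => by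
    rw [← sq_abs]
    exact pow_le_pow_left₀ (abs_nonneg _) (abs_pderiv_cutoff_inl_le hΛ hab i z) 2
  have hy : ∀ j : Fin m,
      (lam z.1 * pderiv (Sum.inr j) (cutoff z₀ Λ a b) z) ^ 2 ≤ ((b - a)⁻¹) ^ 2 := fun j => by
    rw [← sq_abs, abs_mul, abs_of_nonneg h0]
    refine pow_le_pow_left₀ (by positivity) ?_ 2
    calc lam z.1 * |pderiv (Sum.inr j) (cutoff z₀ Λ a b) z| ≤ Λ * ((b - a)⁻¹ * Λ⁻¹) :=
          mul_le_mul h1 (abs_pderiv_cutoff_inr_le hΛ hab j z) (abs_nonneg _) hΛ.le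
      _ = (b - a)⁻¹ := by field_simp
  calc gradSq lam (cutoff z₀ Λ a b) z
      ≤ ∑ _i : Fin n, ((b - a)⁻¹) ^ 2 + ∑ _j : Fin m, ((b - a)⁻¹) ^ 2 :=
        add_le_add (Finset.sum_le_sum fun i _ => hx i) (Finset.sum_le_sum fun j _ => hy j)
    _ = (n + m) * ((b - a)⁻¹) ^ 2 := by simp; ring

/-! ### Truncated powers -/

/-- The derivative of the truncated power: `β s^(β-1)`, stopped at `s = N`. -/
def truncDeriv (β N s : ℝ) : ℝ := β * (max 0 (min s N)) ^ (β - 1)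

/-- The power `t^β`, continued linearly for `t ≥ N`. -/
def truncPow (β N t : ℝ) : ℝ := ∫ s in (0 : ℝ)..t, truncDeriv β N s

/-- The primitive of the square of `truncDeriv`. -/
def truncSq (β N t : ℝ) : ℝ := ∫ s in (0 : ℝ)..t, truncDeriv β N s ^ 2

section

variable {β N : ℝ}

theorem continuous_truncDeriv (hβ : 1 ≤ β) (N : ℝ) : Continuous (truncDeriv β N) :=
  continuous_const.mul ((Real.continuous_rpow_const (by linarith)).comp
    (continuous_const.max (continuous_id.min continuous_const)))

theorem truncDeriv_nonneg (hβ : 1 ≤ β) (s : ℝ) : 0 ≤ truncDeriv β N s :=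
  mul_nonneg (by linarith) (Real.rpow_nonneg (le_max_left _ _) _)

theorem truncDeriv_mono (hβ : 1 ≤ β) : Monotone (truncDeriv β N) := fun s t hst =>
  mul_le_mul_of_nonneg_left (Real.rpow_le_rpow (le_max_left _ _)
    (max_le_max le_rfl (min_le_min hst le_rfl)) (by linarith)) (by linarith)

theorem truncDeriv_of_le {s : ℝ} (hs : 0 ≤ s) (hsN : s ≤ N) :
    truncDeriv β N s = β * s ^ (β - 1) := by
  rw [truncDeriv, min_eq_left hsN, max_eq_right hs]

theorem truncDeriv_of_ge {s : ℝ} (hN : 0 ≤ N) (hs : N ≤ s) :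
    truncDeriv β N s = β * N ^ (β - 1) := by
  rw [truncDeriv, min_eq_right hs, max_eq_right hN]

theorem truncDeriv_le (hβ : 1 ≤ β) (hN : 0 ≤ N) (s : ℝ) : truncDeriv β N s ≤ β * N ^ (β - 1) :=
  mul_le_mul_of_nonneg_left (Real.rpow_le_rpow (le_max_left _ _)
    (max_le hN (min_le_right _ _)) (by linarith)) (by linarith)

theorem hasDerivAt_truncPow (hβ : 1 ≤ β) (t : ℝ) :
    HasDerivAt (truncPow β N) (truncDeriv β N t) t :=
  intervalIntegral.integral_hasDerivAt_right
    ((continuous_truncDeriv hβ N).intervalIntegrable _ _)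
    ((continuous_truncDeriv hβ N).stronglyMeasurableAtFilter _ _)
    (continuous_truncDeriv hβ N).continuousAt

theorem hasDerivAt_truncSq (hβ : 1 ≤ β) (t : ℝ) :
    HasDerivAt (truncSq β N) (truncDeriv β N t ^ 2) t := by
  have hc : Continuous fun s => truncDeriv β N s ^ 2 := (continuous_truncDeriv hβ N).pow 2
  exact intervalIntegral.integral_hasDerivAt_right (hc.intervalIntegrable _ _)
    (hc.stronglyMeasurableAtFilter _ _) hc.continuousAt

@[simp] theorem truncPow_zero : truncPow β N 0 = 0 := intervalIntegral.integral_same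

theorem lipschitzWith_truncPow (hβ : 1 ≤ β) (hN : 0 ≤ N) :
    LipschitzWith (Real.toNNReal (β * N ^ (β - 1))) (truncPow β N) := by
  refine lipschitzWith_of_nnnorm_deriv_le (fun t => (hasDerivAt_truncPow hβ t).differentiableAt)
    fun t => ?_
  rw [(hasDerivAt_truncPow hβ t).deriv, ← NNReal.coe_le_coe, coe_nnnorm, Real.norm_eq_abs,
    abs_of_nonneg (truncDeriv_nonneg hβ t), Real.coe_toNNReal _ (by positivity)]
  exact truncDeriv_le hβ hN t

theorem lipschitzWith_truncSq (hβ : 1 ≤ β) (hN : 0 ≤ N) :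
    LipschitzWith (Real.toNNReal ((β * N ^ (β - 1)) ^ 2)) (truncSq β N) := by
  refine lipschitzWith_of_nnnorm_deriv_le (fun t => (hasDerivAt_truncSq hβ t).differentiableAt)
    fun t => ?_
  rw [(hasDerivAt_truncSq hβ t).deriv, ← NNReal.coe_le_coe, coe_nnnorm, Real.norm_eq_abs,
    abs_of_nonneg (by positivity), Real.coe_toNNReal _ (by positivity)]
  exact pow_le_pow_left₀ (truncDeriv_nonneg hβ t) (truncDeriv_le hβ hN t) 2

theorem truncPow_nonneg (hβ : 1 ≤ β) {t : ℝ} (ht : 0 ≤ t) : 0 ≤ truncPow β N t :=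
  intervalIntegral.integral_nonneg ht fun s _ => truncDeriv_nonneg hβ s

theorem truncSq_nonneg {t : ℝ} (ht : 0 ≤ t) : 0 ≤ truncSq β N t :=
  intervalIntegral.integral_nonneg ht fun _ _ => sq_nonneg _

/-- `(H')²` is non-decreasing on `[0, t]`, so its integral is at most the length times the last
value. This is the estimate `G ≤ t (H')²` of the Caccioppoli argument. -/
theorem truncSq_le (hβ : 1 ≤ β) {t : ℝ} (ht : 0 ≤ t) :
    truncSq β N t ≤ t * truncDeriv β N t ^ 2 := by
  have h : t * truncDeriv β N t ^ 2 = ∫ _ in (0 : ℝ)..t, truncDeriv β N t ^ 2 := by simp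
  rw [h]
  refine intervalIntegral.integral_mono_on ht
    (((continuous_truncDeriv hβ N).pow 2).intervalIntegrable _ _) intervalIntegrable_const ?_
  exact fun s hs => pow_le_pow_left₀ (truncDeriv_nonneg hβ s) (truncDeriv_mono hβ hs.2) 2

theorem truncPow_of_le (hβ : 1 ≤ β) {t : ℝ} (ht : 0 ≤ t) (htN : t ≤ N) :
    truncPow β N t = t ^ β := by
  have h : truncPow β N t = ∫ s in (0 : ℝ)..t, β * s ^ (β - 1) := by
    refine intervalIntegral.integral_congr fun s hs => ?_
    rw [uIcc_of_le ht] at hs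
    exact truncDeriv_of_le hs.1 (hs.2.trans htN)
  rw [h, intervalIntegral.integral_const_mul, integral_rpow (Or.inl (by linarith))]
  rw [sub_add_cancel, Real.zero_rpow (by linarith), sub_zero]
  field_simp

theorem truncPow_of_ge (hβ : 1 ≤ β) (hN : 0 ≤ N) {t : ℝ} (ht : N ≤ t) :
    truncPow β N t = N ^ β + β * N ^ (β - 1) * (t - N) := by
  have hc := continuous_truncDeriv hβ N
  have h := intervalIntegral.integral_add_adjacent_intervals (hc.intervalIntegrable (μ := volume) 0 N)
    (hc.intervalIntegrable (μ := volume) N t)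
  have h2 : ∫ s in N..t, truncDeriv β N s = ∫ _ in N..t, β * N ^ (β - 1) := by
    refine intervalIntegral.integral_congr fun s hs => ?_
    rw [uIcc_of_le ht] at hs
    exact truncDeriv_of_ge hN hs.1
  have h3 := truncPow_of_le hβ hN le_rfl
  rw [truncPow] at h3 ⊢
  rw [← h, h3, h2, intervalIntegral.integral_const, smul_eq_mul]
  ring

theorem truncPow_le_rpow (hβ : 1 ≤ β) {t : ℝ} (ht : 0 ≤ t) :
    truncPow β N t ≤ t ^ β := by
  have h : ∫ s in (0 : ℝ)..t, truncDeriv β t s = t ^ β := truncPow_of_le hβ ht le_rfl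
  rw [← h]
  refine intervalIntegral.integral_mono_on ht
    ((continuous_truncDeriv hβ N).intervalIntegrable _ _)
    ((continuous_truncDeriv hβ t).intervalIntegrable _ _) fun s hs => ?_
  rw [truncDeriv_of_le hs.1 hs.2]
  refine mul_le_mul_of_nonneg_left (Real.rpow_le_rpow (le_max_left _ _)
    (max_le hs.1 (min_le_left _ _)) (by linarith)) (by linarith)

/-- Equality holds in the power range. Beyond `N` the difference of the two sides is `β(β-1) N^{β-1}
(t-N) ≥ 0`. This is where the factor `β` enters the estimates, independently of `N`. -/
theorem mul_truncDeriv_le (hβ : 1 ≤ β) (hN : 0 < N) {t : ℝ} (ht : 0 ≤ t) :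
    t * truncDeriv β N t ≤ β * truncPow β N t := by
  have hpow : ∀ s : ℝ, 0 ≤ s → s * s ^ (β - 1) = s ^ β := fun s hs => by
    rcases hs.eq_or_lt with rfl | hs
    · rw [zero_mul, Real.zero_rpow (by linarith)]
    · rw [Real.rpow_sub_one hs.ne']; field_simp
  rcases le_total t N with h | h
  · rw [truncDeriv_of_le ht h, truncPow_of_le hβ ht h, mul_left_comm, hpow t ht]
  · rw [truncDeriv_of_ge hN.le h, truncPow_of_ge hβ hN.le h, ← hpow N hN.le]
    have h1 : 0 ≤ N ^ (β - 1) := by positivity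
    have : 0 ≤ β * (β - 1) * N ^ (β - 1) * (t - N) :=
      mul_nonneg (mul_nonneg (mul_nonneg (by linarith) (by linarith)) h1) (by linarith)
    nlinarith

end

/-! ### Caccioppoli estimates for Lipschitz functions -/

open Matrix in
/-- The bilinear form of a matrix. -/
def form (A : Matrix (Fin n ⊕ Fin m) (Fin n ⊕ Fin m) ℝ) (p r : Fin n ⊕ Fin m → ℝ) : ℝ :=
  p ⬝ᵥ (A *ᵥ r)

theorem form_eq_sum (A : Matrix (Fin n ⊕ Fin m) (Fin n ⊕ Fin m) ℝ) (p r : Fin n ⊕ Fin m → ℝ) :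
    form A p r = ∑ i, ∑ j, A i j * p i * r j := by
  simp only [form, dotProduct, Matrix.mulVec, Finset.mul_sum]
  exact Finset.sum_congr rfl fun i _ => Finset.sum_congr rfl fun j _ => by ring

theorem form_symm {A : Matrix (Fin n ⊕ Fin m) (Fin n ⊕ Fin m) ℝ} (hA : A.IsSymm)
    (p r : Fin n ⊕ Fin m → ℝ) : form A r p = form A p r := by
  unfold form
  rw [Matrix.dotProduct_mulVec, ← Matrix.mulVec_transpose, hA.eq, dotProduct_comm]

theorem form_comb_right (A : Matrix (Fin n ⊕ Fin m) (Fin n ⊕ Fin m) ℝ)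
    (p q r : Fin n ⊕ Fin m → ℝ) (c d : ℝ) :
    form A p (c • q + d • r) = c * form A p q + d * form A p r := by
  simp [form, Matrix.mulVec_add, Matrix.mulVec_smul, dotProduct_add, dotProduct_smul]

theorem form_comb_self {A : Matrix (Fin n ⊕ Fin m) (Fin n ⊕ Fin m) ℝ} (hA : A.IsSymm)
    (p r : Fin n ⊕ Fin m → ℝ) (c d : ℝ) :
    form A (c • p + d • r) (c • p + d • r) =
      c ^ 2 * form A p p + 2 * c * d * form A p r + d ^ 2 * form A r r := by
  rw [form_comb_right, form_symm hA p, form_symm hA r, form_comb_right, form_comb_right,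
    form_symm hA p r]
  ring

/-- The gradient of `g` at `z`, as a vector of partial derivatives. -/
def grad (g : GPt n m → ℝ) (z : GPt n m) : Fin n ⊕ Fin m → ℝ := fun i => pderiv i g z

theorem grushinForm_grad (lam : EuclideanSpace ℝ (Fin n) → ℝ) (g : GPt n m → ℝ) (z : GPt n m) :
    grushinForm lam z (grad g z) = gradSq lam g z := by
  simp only [grushinForm, gradSq, grad, mul_pow, Finset.mul_sum]

theorem gradSq_nonneg (lam : EuclideanSpace ℝ (Fin n) → ℝ) (g : GPt n m → ℝ) (z : GPt n m) :
    0 ≤ gradSq lam g z := by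
  unfold gradSq; positivity

theorem grad_comp_mul {η F φ ψ : _} {z : GPt n m} (hη : DifferentiableAt ℝ η z)
    (hF : DifferentiableAt ℝ F z) {a b : ℝ} (hφ : HasDerivAt φ a (F z))
    (hψ : HasDerivAt ψ b (η z)) :
    grad (fun w => ψ (η w) * φ (F w)) z =
      (ψ (η z) * a) • grad F z + (φ (F z) * b) • grad η z := by
  have h1 := hφ.comp_hasFDerivAt z hF.hasFDerivAt
  have h2 := hψ.comp_hasFDerivAt z hη.hasFDerivAt
  have h3 := h2.mul h1
  funext i
  simp only [grad, pderiv, Pi.add_apply, Pi.smul_apply, smul_eq_mul]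
  have e : fderiv ℝ (fun w => ψ (η w) * φ (F w)) z = _ := h3.fderiv
  rw [e]
  simp
  ring

variable {D : Operator n m} {Ω : Domain n m}

theorem form_integrable (f g : Lip D Ω) :
    IntegrableOn (fun z => form (D.A z) (grad f z) (grad g z)) Ω.carrier := by
  simp only [form_eq_sum]
  exact integrable_finsetSum _ fun i _ => integrable_finsetSum _ fun j _ => energy_integrable f g i j

theorem energy_eq_integral_form (f g : Lip D Ω) :
    energy f g = ∫ z in Ω.carrier, form (D.A z) (grad f z) (grad g z) := by
  simp only [form_eq_sum, grad]
  rw [integral_finsetSum _ fun i _ => integrable_finsetSum _ fun j _ => energy_integrable f g i j]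
  refine Finset.sum_congr rfl fun i _ => ?_
  rw [integral_finsetSum _ fun j _ => energy_integrable f g i j]

theorem form_ellipticity (D : Operator n m) : ∀ᵐ z, ∀ p,
    D.v z * grushinForm D.lam z p ≤ form (D.A z) p p ∧
      form (D.A z) p p ≤ D.u z * grushinForm D.lam z p := by
  filter_upwards [D.ellipticity] with z hz p
  rw [form_eq_sum]
  exact hz p

theorem form_nonneg (D : Operator n m) : ∀ᵐ z, ∀ p, 0 ≤ form (D.A z) p p := by
  filter_upwards [form_ellipticity D] with z hz p
  refine le_trans (mul_nonneg (D.v_weight.nonneg z) ?_) (hz p).1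
  unfold grushinForm
  positivity

/-- The algebra behind the Caccioppoli inequality; `P`, `X`, `E` stand for the values of a
positive semidefinite form. -/
theorem caccioppoli_pointwise {P X E η d G H F β : ℝ}
    (hpsd : ∀ a b : ℝ, 0 ≤ a ^ 2 * P + 2 * a * b * X + b ^ 2 * E) (hd : 0 ≤ d)
    (hG : 0 ≤ G) (hGF : G ≤ F * d ^ 2) (hFd : F * d ≤ β * H) (hβ : 1 ≤ β) :
    (η * d) ^ 2 * P + 2 * (η * d) * H * X + H ^ 2 * E ≤
      4 * (η ^ 2 * d ^ 2 * P + G * (2 * η) * X) + 10 * β ^ 2 * H ^ 2 * E := by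
  have hE : 0 ≤ E := by simpa using hpsd 0 1
  -- `K` stands for `G / H'`. When `H' = 0` the bound on `G` forces `G = 0`, and `K = 0` serves.
  obtain ⟨K, hK0, hKd, hKF⟩ : ∃ K : ℝ, 0 ≤ K ∧ d * K = G ∧ K ≤ F * d := by
    rcases hd.eq_or_lt with rfl | hd
    · exact ⟨0, le_rfl, by nlinarith, by simp⟩
    · refine ⟨G / d, by positivity, by field_simp, ?_⟩
      rw [div_le_iff₀ hd]; linarith [hGF, sq d]
  -- Two Cauchy-Schwarz inequalities. The first bounds the left side by `2(ηd)²P + 2H²E`. The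
  -- second, used twice, bounds `8ηGX` below by `-2(ηd)²P - 8K²E`. Since `K² ≤ β²H²` and `H² ≤
  -- β²H²`, this leaves `10 = 8 + 2` copies of `β²H²E`.
  have h1 := hpsd (η * d) (-H)
  have h2 := hpsd (η * d) (2 * K)
  have h3 : K ^ 2 ≤ β ^ 2 * H ^ 2 := by
    rw [← mul_pow]; exact pow_le_pow_left₀ hK0 (hKF.trans hFd) 2
  have h4 : H ^ 2 ≤ β ^ 2 * H ^ 2 :=
    le_mul_of_one_le_left (sq_nonneg H) (one_le_pow₀ hβ)
  have h5 := mul_le_mul_of_nonneg_right h3 hE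
  have h6 := mul_le_mul_of_nonneg_right h4 hE
  have h7 : η * d * K * X = η * G * X := by rw [mul_assoc η, hKd]
  nlinarith

/-- A cutoff function for the operator `D`: Lipschitz, with values in `[0, 1]`, supported in a
compact subset of `S`, with `|∇_λ η|² ≤ L` on `S`. -/
structure IsCutoff (lam : EuclideanSpace ℝ (Fin n) → ℝ) (S : Set (GPt n m)) (L : ℝ)
    (η : GPt n m → ℝ) : Prop where
  lipschitz : ∃ K, LipschitzWith K η
  nonneg : ∀ z, 0 ≤ η z
  le_one : ∀ z, η z ≤ 1
  support : ∃ K, IsCompact K ∧ K ⊆ S ∧ ∀ z ∉ K, η z = 0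
  gradSq_le : ∀ z ∈ S, gradSq lam η z ≤ L

/-- The upper ellipticity bound is applied to `∇η`. Off `S` the point lies outside the compact
support of `η`, whose complement is open, so the gradient vanishes there. -/
theorem IsCutoff.form_le {S : Set (GPt n m)} {L : ℝ} {η : GPt n m → ℝ}
    (hη : IsCutoff D.lam S L η) :
    ∀ᵐ z, form (D.A z) (grad η z) (grad η z) ≤ S.indicator (fun z => L * D.u z) z := by
  obtain ⟨K, hK, hKS, hK0⟩ := hη.support
  filter_upwards [form_ellipticity D] with z hz
  by_cases hzS : z ∈ S
  · rw [indicator_of_mem hzS, mul_comm]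
    refine (hz _).2.trans (mul_le_mul_of_nonneg_left ?_ (D.u_weight.nonneg z))
    rw [grushinForm_grad]
    exact hη.gradSq_le z hzS
  · rw [indicator_of_notMem hzS]
    have : grad η z = 0 := funext fun i =>
      pderiv_eq_zero_of_notMem hK.isClosed hK0 i fun h => hzS (hKS h)
    rw [this]
    simp [form]

theorem IsCutoff.L_nonneg {lam : EuclideanSpace ℝ (Fin n) → ℝ} {S : Set (GPt n m)} {L : ℝ}
    {η : GPt n m → ℝ} (hη : IsCutoff lam S L η) (hS : S.Nonempty) : 0 ≤ L :=
  (gradSq_nonneg lam η _).trans (hη.gradSq_le _ hS.choose_spec)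

/-- A bounded Lipschitz function on the whole space, with non-negative values. -/
structure IsBddLip (F : GPt n m → ℝ) : Prop where
  lipschitz : ∃ K, LipschitzWith K F
  nonneg : ∀ z, 0 ≤ F z
  bdd : ∃ M, ∀ z, F z ≤ M

theorem IsBddLip.mul {F G : GPt n m → ℝ} (hF : IsBddLip F) (hG : IsBddLip G) :
    IsBddLip fun z => F z * G z := by
  obtain ⟨⟨K, hK⟩, hF0, M, hM⟩ := hF
  obtain ⟨⟨K', hK'⟩, hG0, M', hM'⟩ := hG
  have hM0 : 0 ≤ M := (hF0 0).trans (hM 0)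
  have hM0' : 0 ≤ M' := (hG0 0).trans (hM' 0)
  refine ⟨⟨Real.toNNReal (M * K' + M' * K), LipschitzWith.of_dist_le_mul fun z w => ?_⟩,
    fun z => mul_nonneg (hF0 z) (hG0 z), M * M', fun z => mul_le_mul (hM z) (hM' z) (hG0 z) hM0⟩
  have h1 := hK.dist_le_mul z w
  have h2 := hK'.dist_le_mul z w
  rw [Real.coe_toNNReal _ (by positivity)]
  rw [Real.dist_eq] at h1 h2 ⊢
  calc |F z * G z - F w * G w| = |F z * (G z - G w) + G w * (F z - F w)| := by congr 1; ring
    _ ≤ |F z| * |G z - G w| + |G w| * |F z - F w| := by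
        rw [← abs_mul, ← abs_mul]; exact abs_add_le _ _
    _ ≤ M * (K' * dist z w) + M' * (K * dist z w) := by
        rw [abs_of_nonneg (hF0 z), abs_of_nonneg (hG0 w)]
        have := hM z; have := hM' w; have := hF0 z; have := hG0 w
        gcongr
    _ = (M * K' + M' * K) * dist z w := by ring

theorem IsBddLip.comp {F : GPt n m → ℝ} (hF : IsBddLip F) {φ : ℝ → ℝ} {K : ℝ≥0}
    (hφ : LipschitzWith K φ) (hφ0 : ∀ t, 0 ≤ t → 0 ≤ φ t) : IsBddLip fun z => φ (F z) := by
  obtain ⟨⟨K', hK'⟩, hF0, M, hM⟩ := hF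
  refine ⟨⟨_, hφ.comp hK'⟩, fun z => hφ0 _ (hF0 z), φ 0 + K * M, fun z => ?_⟩
  have h := hφ.le_add_mul (F z) 0
  rw [dist_zero_right, Real.norm_eq_abs, abs_of_nonneg (hF0 z)] at h
  exact h.trans (add_le_add_right (mul_le_mul_of_nonneg_left (hM z) K.2) _)

theorem IsCutoff.isBddLip {lam : EuclideanSpace ℝ (Fin n) → ℝ} {S : Set (GPt n m)} {L : ℝ}
    {η : GPt n m → ℝ} (hη : IsCutoff lam S L η) : IsBddLip η :=
  ⟨hη.lipschitz, hη.nonneg, 1, hη.le_one⟩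

/-- A globally Lipschitz function, as an element of `Lip D Ω`. -/
def IsBddLip.toLip {F : GPt n m → ℝ} (hF : IsBddLip F) (D : Operator n m) (Ω : Domain n m) :
    Lip D Ω :=
  (⟨F, hF.lipschitz.choose, hF.lipschitz.choose_spec.lipschitzOnWith⟩ : lipSubmodule Ω)

@[simp] theorem IsBddLip.coe_toLip {F : GPt n m → ℝ} (hF : IsBddLip F) (D : Operator n m)
    (Ω : Domain n m) : (hF.toLip D Ω : GPt n m → ℝ) = F := rfl

theorem IsBddLip.truncPow {F : GPt n m → ℝ} (hF : IsBddLip F) {β N : ℝ} (hβ : 1 ≤ β)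
    (hN : 0 ≤ N) : IsBddLip fun z => truncPow β N (F z) :=
  hF.comp (lipschitzWith_truncPow hβ hN) fun _ => truncPow_nonneg hβ

theorem IsBddLip.truncSq {F : GPt n m → ℝ} (hF : IsBddLip F) {β N : ℝ} (hβ : 1 ≤ β)
    (hN : 0 ≤ N) : IsBddLip fun z => truncSq β N (F z) :=
  hF.comp (lipschitzWith_truncSq hβ hN) fun _ => truncSq_nonneg

/-- The test function `η² ∫₀^F (H')²`. -/
def testFun (η F : GPt n m → ℝ) (β N : ℝ) (z : GPt n m) : ℝ := η z ^ 2 * truncSq β N (F z)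

theorem grad_testFun {η F : GPt n m → ℝ} {β N : ℝ} {z : GPt n m} (hη : DifferentiableAt ℝ η z)
    (hF : DifferentiableAt ℝ F z) (hβ : 1 ≤ β) :
    grad (testFun η F β N) z = (η z ^ 2 * truncDeriv β N (F z) ^ 2) • grad F z +
      (truncSq β N (F z) * (2 * η z)) • grad η z := by
  have e : testFun η F β N = fun w => η w ^ 2 * truncSq β N (F w) := rfl
  rw [e]
  simpa using
    grad_comp_mul hη hF (hasDerivAt_truncSq (N := N) hβ (F z)) (hasDerivAt_pow 2 _)

theorem isBddLip_testFun {η F : GPt n m → ℝ} (hη : IsBddLip η) (hF : IsBddLip F) {β N : ℝ}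
    (hβ : 1 ≤ β) (hN : 0 ≤ N) : IsBddLip (testFun η F β N) := by
  have := (hη.mul hη).mul (hF.truncSq hβ hN)
  simp only [← sq] at this
  exact this

theorem IsBddLip.ae_differentiableAt {F : GPt n m → ℝ} (hF : IsBddLip F) :
    ∀ᵐ z, DifferentiableAt ℝ F z :=
  hF.lipschitz.choose_spec.ae_differentiableAt

theorem IsBddLip.integrableOn_gradSq {F : GPt n m → ℝ} (hF : IsBddLip F) (D : Operator n m)
    (Ω : Domain n m) {w : GPt n m → ℝ} (hw : IsWeight w) :
    IntegrableOn (fun z => gradSq D.lam F z * w z) Ω.carrier := by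
  obtain ⟨M, hM0, hM⟩ := pderiv_bound (hF.toLip D Ω)
  obtain ⟨S, hS⟩ := (isCompact_closure Ω).exists_bound_of_continuousOn
    (f := fun z : GPt n m => D.lam z.1)
    ((D.lam_admissible.continuous.comp continuous_fst).continuousOn)
  have hwi : IntegrableOn w Ω.carrier :=
    (hw.locallyIntegrable.integrableOn_isCompact (isCompact_closure Ω)).mono_set subset_closure
  refine Integrable.bdd_mul (c := n * M ^ 2 + m * (S * M) ^ 2) hwi ?_ ?_
  · refine Measurable.aestronglyMeasurable ?_
    unfold gradSq
    have hl : Measurable fun z : GPt n m => D.lam z.1 :=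
      (D.lam_admissible.continuous.comp continuous_fst).measurable
    exact (Finset.measurable_sum _ fun i _ => (pderiv_measurable _ F).pow_const 2).add
      (Finset.measurable_sum _ fun j _ => (hl.mul (pderiv_measurable _ F)).pow_const 2)
  · rw [ae_restrict_iff' Ω.isOpen.measurableSet]
    refine Eventually.of_forall fun z hz => ?_
    rw [Real.norm_eq_abs, abs_of_nonneg (gradSq_nonneg _ _ _)]
    have h1 : ∀ i, |pderiv i F z| ≤ M := fun i => hM i z hz
    have h2 : |D.lam z.1| ≤ S := hS z (subset_closure hz)
    have hx : ∀ i : Fin n, pderiv (Sum.inl i) F z ^ 2 ≤ M ^ 2 := fun i => by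
      rw [← sq_abs]; exact pow_le_pow_left₀ (abs_nonneg _) (h1 _) 2
    have hy : ∀ j : Fin m, (D.lam z.1 * pderiv (Sum.inr j) F z) ^ 2 ≤ (S * M) ^ 2 := fun j => by
      rw [← sq_abs, abs_mul]
      exact pow_le_pow_left₀ (by positivity)
        (mul_le_mul h2 (h1 _) (abs_nonneg _) ((abs_nonneg _).trans h2)) 2
    calc gradSq D.lam F z ≤ ∑ _i : Fin n, M ^ 2 + ∑ _j : Fin m, (S * M) ^ 2 :=
          add_le_add (Finset.sum_le_sum fun i _ => hx i) (Finset.sum_le_sum fun j _ => hy j)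
      _ = _ := by simp

theorem IsBddLip.integrableOn_sq {F : GPt n m → ℝ} (hF : IsBddLip F) (D : Operator n m)
    (Ω : Domain n m) : IntegrableOn (fun z => F z ^ 2 * D.u z) Ω.carrier := by
  simpa [sq] using mass_integrable (hF.toLip D Ω) (hF.toLip D Ω)

/-- The Caccioppoli inequality, before the equation is used. -/
theorem integral_gradSq_le {S : Set (GPt n m)} (hS : MeasurableSet S) (hSΩ : S ⊆ Ω.carrier)
    {L : ℝ} {η F : GPt n m → ℝ} (hη : IsCutoff D.lam S L η) (hF : IsBddLip F) {β N : ℝ}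
    (hβ : 1 ≤ β) (hN : 0 < N) :
    ∫ z in Ω.carrier, gradSq D.lam (fun w => η w * truncPow β N (F w)) z * D.v z ≤
      4 * energy (hF.toLip D Ω) ((isBddLip_testFun hη.isBddLip hF hβ hN.le).toLip D Ω) +
        10 * β ^ 2 * L * ∫ z in S, truncPow β N (F z) ^ 2 * D.u z := by
  have hθ := isBddLip_testFun hη.isBddLip hF hβ hN.le
  have hg := hη.isBddLip.mul (hF.truncPow hβ hN.le)
  have i1 := hg.integrableOn_gradSq D Ω D.v_weight
  have i2 := (form_integrable (hF.toLip D Ω) (hθ.toLip D Ω)).const_mul 4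
  have i3 := ((hF.truncPow hβ hN.le).integrableOn_sq D Ω).const_mul (10 * β ^ 2 * L)
  have i3' := i3.indicator hS
  have e3 : ∫ z in Ω.carrier, S.indicator
      (fun z => 10 * β ^ 2 * L * (truncPow β N (F z) ^ 2 * D.u z)) z =
      10 * β ^ 2 * L * ∫ z in S, truncPow β N (F z) ^ 2 * D.u z := by
    rw [setIntegral_indicator hS, inter_eq_self_of_subset_right hSΩ, integral_const_mul]
  rw [energy_eq_integral_form, ← integral_const_mul, ← e3, ← integral_add i2 i3']
  refine integral_mono_ae i1 (i2.add i3') (ae_restrict_of_ae ?_)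
  filter_upwards [form_ellipticity D, form_nonneg D, hη.form_le, hη.isBddLip.ae_differentiableAt,
    hF.ae_differentiableAt] with z hell hnn hcut hdη hdF
  have hsym := D.A_symm z
  have g1 : grad (fun w => η w * truncPow β N (F w)) z =
      (η z * truncDeriv β N (F z)) • grad F z + truncPow β N (F z) • grad η z := by
    simpa using grad_comp_mul hdη hdF (hasDerivAt_truncPow (N := N) hβ (F z)) (hasDerivAt_id _)
  have g2 := grad_testFun (N := N) hdη hdF hβ
  have hpsd : ∀ a b : ℝ, 0 ≤ a ^ 2 * form (D.A z) (grad F z) (grad F z) +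
      2 * a * b * form (D.A z) (grad F z) (grad η z) +
      b ^ 2 * form (D.A z) (grad η z) (grad η z) := fun a b => by
    rw [← form_comb_self hsym]; exact hnn _
  have hF0 := hF.nonneg z
  have key := caccioppoli_pointwise (η := η z) hpsd (truncDeriv_nonneg (N := N) hβ (F z))
    (truncSq_nonneg hF0) (truncSq_le hβ hF0) (mul_truncDeriv_le hβ hN hF0) hβ
  have h1 := (hell (grad (fun w => η w * truncPow β N (F w)) z)).1
  rw [grushinForm_grad, mul_comm, g1, form_comb_self hsym] at h1
  simp only [IsBddLip.coe_toLip]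
  rw [g2, form_comb_right]
  refine h1.trans (key.trans (add_le_add_right ?_ _))
  by_cases hzS : z ∈ S
  · rw [indicator_of_mem hzS] at hcut ⊢
    calc _ ≤ 10 * β ^ 2 * truncPow β N (F z) ^ 2 * (L * D.u z) :=
          mul_le_mul_of_nonneg_left hcut (by positivity)
      _ = _ := by ring
  · rw [indicator_of_notMem hzS] at hcut ⊢
    exact mul_nonpos_of_nonneg_of_nonpos (by positivity) hcut

/-- Only boundedness of the test functions in `H(Ω)` matters, with a constant independent of `F`; it
may depend on `N`. It follows from `G(F) ≤ M² F` and `G'(F) ≤ M²`, where `M = β N^{β-1}` is the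
Lipschitz constant of `H`. -/
theorem norm_testFun_le {S : Set (GPt n m)} (hSne : S.Nonempty)
    {L : ℝ} {η F : GPt n m → ℝ} (hη : IsCutoff D.lam S L η) (hF : IsBddLip F) {β N : ℝ}
    (hβ : 1 ≤ β) (hN : 0 < N) :
    ‖(isBddLip_testFun hη.isBddLip hF hβ hN.le).toLip D Ω‖ ^ 2 ≤
      ((β * N ^ (β - 1)) ^ 4 * (3 + 8 * L)) * ‖hF.toLip D Ω‖ ^ 2 := by
  have hL := hη.L_nonneg hSne
  set M := β * N ^ (β - 1) with hM
  have hM0 : 0 ≤ M := by positivity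
  have hθ := isBddLip_testFun hη.isBddLip hF hβ hN.le
  have hG : ∀ z, truncSq β N (F z) ≤ F z * M ^ 2 := fun z =>
    (truncSq_le hβ (hF.nonneg z)).trans (mul_le_mul_of_nonneg_left
      (pow_le_pow_left₀ (truncDeriv_nonneg hβ _) (truncDeriv_le hβ hN.le _) 2) (hF.nonneg z))
  have hG2 : ∀ z, truncSq β N (F z) ^ 2 ≤ F z ^ 2 * M ^ 4 := fun z =>
    (pow_le_pow_left₀ (truncSq_nonneg (hF.nonneg z)) (hG z) 2).trans_eq (by ring)
  have hη1 : ∀ z k, η z ^ k ≤ 1 := fun z k => pow_le_one₀ (hη.nonneg z) (hη.le_one z)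
  have hmass : mass (hθ.toLip D Ω) (hθ.toLip D Ω) ≤
      M ^ 4 * mass (hF.toLip D Ω) (hF.toLip D Ω) := by
    unfold mass
    rw [← integral_const_mul]
    refine integral_mono (mass_integrable _ _) ((mass_integrable _ _).const_mul _) fun z => ?_
    simp only [IsBddLip.coe_toLip, testFun]
    calc η z ^ 2 * truncSq β N (F z) * (η z ^ 2 * truncSq β N (F z)) * D.u z
        = η z ^ 4 * truncSq β N (F z) ^ 2 * D.u z := by ring
      _ ≤ 1 * (F z ^ 2 * M ^ 4) * D.u z := by
          have := hη1 z 4; have := hG2 z; have := D.u_weight.nonneg z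
          gcongr
      _ = M ^ 4 * (F z * F z * D.u z) := by ring
  have henergy : energy (hθ.toLip D Ω) (hθ.toLip D Ω) ≤
      2 * M ^ 4 * energy (hF.toLip D Ω) (hF.toLip D Ω) +
        8 * M ^ 4 * L * mass (hF.toLip D Ω) (hF.toLip D Ω) := by
    have i2 := (form_integrable (hF.toLip D Ω) (hF.toLip D Ω)).const_mul (2 * M ^ 4)
    have i3 := (mass_integrable (hF.toLip D Ω) (hF.toLip D Ω)).const_mul (8 * M ^ 4 * L)
    rw [energy_eq_integral_form, energy_eq_integral_form, mass, ← integral_const_mul,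
      ← integral_const_mul, ← integral_add i2 i3]
    refine integral_mono_ae (form_integrable _ _) (i2.add i3) (ae_restrict_of_ae ?_)
    filter_upwards [form_nonneg D, hη.form_le, hη.isBddLip.ae_differentiableAt,
      hF.ae_differentiableAt] with z hnn hcut hdη hdF
    have hsym := D.A_symm z
    have g2 := grad_testFun (N := N) hdη hdF hβ
    have hu := D.u_weight.nonneg z
    have hE : form (D.A z) (grad η z) (grad η z) ≤ L * D.u z :=
      hcut.trans (indicator_apply_le' (fun _ => le_rfl) fun _ => by positivity)
    have hE0 := hnn (grad η z)
    have hP0 := hnn (grad F z)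
    set a := η z ^ 2 * truncDeriv β N (F z) ^ 2 with ha
    set b := truncSq β N (F z) * (2 * η z) with hb
    -- Positivity at `a∇F - b∇η` gives `A(a∇F + b∇η) ≤ 2a² A(∇F) + 2b² A(∇η)`.
    have h1 : 0 ≤ a ^ 2 * form (D.A z) (grad F z) (grad F z) +
        2 * a * (-b) * form (D.A z) (grad F z) (grad η z) +
        (-b) ^ 2 * form (D.A z) (grad η z) (grad η z) := by
      rw [← form_comb_self hsym]; exact hnn _
    have ha2 : a ^ 2 ≤ M ^ 4 := by
      calc a ^ 2 = η z ^ 4 * truncDeriv β N (F z) ^ 4 := by rw [ha]; ring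
        _ ≤ 1 * M ^ 4 := mul_le_mul (hη1 z 4)
            (pow_le_pow_left₀ (truncDeriv_nonneg hβ _) (truncDeriv_le hβ hN.le _) 4)
            (pow_nonneg (truncDeriv_nonneg hβ _) 4) zero_le_one
        _ = M ^ 4 := one_mul _
    have hb2 : b ^ 2 ≤ 4 * (F z ^ 2 * M ^ 4) := by
      calc b ^ 2 = 4 * (η z ^ 2 * truncSq β N (F z) ^ 2) := by rw [hb]; ring
        _ ≤ 4 * (1 * (F z ^ 2 * M ^ 4)) := by
            have := hη1 z 2; have := hG2 z
            gcongr
        _ = _ := by ring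
    simp only [IsBddLip.coe_toLip]
    rw [g2, form_comb_self hsym]
    have h3 := mul_le_mul_of_nonneg_right ha2 hP0
    have h4 : b ^ 2 * form (D.A z) (grad η z) (grad η z) ≤ 4 * (F z ^ 2 * M ^ 4) * (L * D.u z) :=
      mul_le_mul hb2 hE hE0 (by positivity)
    nlinarith
  rw [lip_norm_sq, lip_norm_sq]
  have e0 := energy_self_nonneg (hF.toLip D Ω)
  have m0 := mass_self_nonneg (hF.toLip D Ω)
  have : 0 ≤ M ^ 4 * energy (hF.toLip D Ω) (hF.toLip D Ω) := by positivity
  have : 0 ≤ M ^ 4 * mass (hF.toLip D Ω) (hF.toLip D Ω) := by positivity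
  have : 0 ≤ M ^ 4 * L * energy (hF.toLip D Ω) (hF.toLip D Ω) := by positivity
  nlinarith

/-! ### Approximation by bounded Lipschitz functions -/

/-- The seminorm sees only the open set `Ω`, where vanishing of `φ` carries over to its derivatives.
Such functions are identified with `0` in the completion. -/
theorem norm_eq_zero_of_eqOn {φ : Lip D Ω} (h : ∀ z ∈ Ω.carrier, φ z = 0) : ‖φ‖ = 0 := by
  have hp : ∀ i, ∀ z ∈ Ω.carrier, pderiv i φ z = 0 := by
    intro i z hz
    have : (φ : GPt n m → ℝ) =ᶠ[𝓝 z] fun _ => (0 : ℝ) := by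
      filter_upwards [Ω.isOpen.mem_nhds hz] with w hw using h w hw
    rw [pderiv, this.fderiv_eq]
    simp
  have he : energy φ φ = 0 := by
    unfold energy
    refine Finset.sum_eq_zero fun i _ => Finset.sum_eq_zero fun j _ => ?_
    refine setIntegral_eq_zero_of_forall_eq_zero fun z hz => ?_
    rw [hp i z hz]; ring
  have hm : mass φ φ = 0 := by
    refine setIntegral_eq_zero_of_forall_eq_zero fun z hz => ?_
    rw [h z hz]; ring
  have := lip_norm_sq φ
  rw [he, hm, add_zero] at this
  exact pow_eq_zero_iff two_ne_zero |>.1 this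

/-- A Lipschitz extension to the whole space is clamped to `[0, M]`, which changes nothing on `Ω`.
Global Lipschitz functions are needed to apply the Sobolev-Poincaré hypothesis. -/
theorem exists_isBddLip_eq (F : Lip D Ω) (hF : ∀ z ∈ closure Ω.carrier, 0 ≤ F z) :
    ∃ (G : GPt n m → ℝ) (hG : IsBddLip G), ((hG.toLip D Ω : Lip D Ω) : H D Ω) = (F : H D Ω) := by
  obtain ⟨K, hK⟩ := F.lipschitz
  obtain ⟨M, hM0, hM⟩ := lip_bound F
  obtain ⟨g, hg, hgF⟩ := hK.extend_real
  have hG : IsBddLip fun z => min (max (g z) 0) M :=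
    ⟨⟨K, (hg.max_const 0).min_const M⟩, fun z => le_min (le_max_right _ _) hM0,
      M, fun z => min_le_right _ _⟩
  refine ⟨_, hG, eq_of_dist_eq_zero ?_⟩
  rw [UniformSpace.Completion.dist_eq, dist_eq_norm]
  refine norm_eq_zero_of_eqOn fun z hz => ?_
  have h1 := hF z (subset_closure hz)
  have h2 := (le_abs_self _).trans (hM z hz)
  have h3 : F z = g z := hgF (subset_closure hz)
  change min (max (g z) 0) M - F z = 0
  rw [← h3, max_eq_left h1, min_eq_left h2, sub_self]

/-- A non-negative element of `H(Ω)` is the limit of bounded non-negative Lipschitz functions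
which also converge almost everywhere. -/
theorem IsNonneg.exists_seq {f : H D Ω} (hf : IsNonneg f) :
    ∃ (F : ℕ → GPt n m → ℝ) (hF : ∀ k, IsBddLip (F k)),
      Tendsto (fun k => (((hF k).toLip D Ω : Lip D Ω) : H D Ω)) atTop (𝓝 f) ∧
      (∀ᵐ z ∂((weightMeasure D.u).restrict Ω.carrier),
        Tendsto (fun k => F k z) atTop (𝓝 (tilde f z))) ∧
      Tendsto (fun k => eLpNorm (fun z => F k z - tilde f z) 2
        ((weightMeasure D.u).restrict Ω.carrier)) atTop (𝓝 0) := by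
  obtain ⟨F₀, hF₀, hlim₀⟩ := hf
  choose F hF hFe using fun k => exists_isBddLip_eq (F₀ k) (hF₀ k)
  have hlim : Tendsto (fun k => (((hF k).toLip D Ω : Lip D Ω) : H D Ω)) atTop (𝓝 f) := by
    simpa only [hFe] using hlim₀
  have hL := (tilde.continuous.tendsto f).comp hlim
  simp only [Function.comp_def, tilde_coe] at hL
  have hmem : ∀ k, MemLp (F k) 2 ((weightMeasure D.u).restrict Ω.carrier) :=
    fun k => lip_memLp ((hF k).toLip D Ω)
  have hL2 : Tendsto (fun k => eLpNorm (fun z => F k z - tilde f z) 2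
      ((weightMeasure D.u).restrict Ω.carrier)) atTop (𝓝 0) := by
    have h1 := (Lp.tendsto_Lp_iff_tendsto_eLpNorm' _ _).1 hL
    refine h1.congr fun k => eLpNorm_congr_ae ?_
    filter_upwards [(hmem k).coeFn_toLp] with z hz
    change (hmem k).toLp (F k) z - _ = _
    rw [hz]
  -- Convergence in `L²(u dz)` gives almost everywhere convergence only along a subsequence, to
  -- which the whole sequence is now restricted.
  have hmeas := tendstoInMeasure_of_tendsto_eLpNorm two_ne_zero
    (fun k => (hmem k).1) (Lp.aestronglyMeasurable (tilde f)) hL2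
  obtain ⟨ns, hns, hae⟩ := hmeas.exists_seq_tendsto_ae
  exact ⟨fun k => F (ns k), fun k => hF (ns k), hlim.comp hns.tendsto_atTop, hae,
    hL2.comp hns.tendsto_atTop⟩

theorem IsNonneg.tilde_nonneg {f : H D Ω} (hf : IsNonneg f) :
    ∀ᵐ z ∂((weightMeasure D.u).restrict Ω.carrier), 0 ≤ tilde f z := by
  obtain ⟨F, hF, -, hae, -⟩ := hf.exists_seq
  filter_upwards [hae] with z hz
  exact ge_of_tendsto' hz fun k => (hF k).nonneg z

theorem a0_add_left (f g k : H D Ω) : a0 (f + g) k = a0 f k + a0 g k := by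
  unfold a0
  rw [map_add, inner_add_left, inner_add_left]
  ring

theorem a0_le (f g : H D Ω) :
    a0 f g ≤ (1 + ‖(tilde : H D Ω →L[ℝ] L2u D Ω)‖ ^ 2) * (‖f‖ * ‖g‖) := by
  have h1 := real_inner_le_norm f g
  have h2 := (abs_le.1 (abs_real_inner_le_norm (tilde f) (tilde g))).1
  have h3 := mul_le_mul (tilde.le_opNorm f) (tilde.le_opNorm g) (norm_nonneg _) (by positivity)
  unfold a0
  nlinarith

/-- Write `a₀(F_k, θ_k) = a₀(f, θ_k) + a₀(F_k - f, θ_k)`, with `θ_k` the test function built from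
`F_k`. The first term is non-positive by the subsolution property. The second is at most a constant
times `‖F_k - f‖ ‖θ_k‖`, and `‖θ_k‖` is bounded by a multiple of `‖F_k‖`. -/
theorem IsSubsolution.energy_testFun_le {f : H D Ω} (hf : IsSubsolution f)
    {F : ℕ → GPt n m → ℝ} (hF : ∀ k, IsBddLip (F k))
    (hlim : Tendsto (fun k => (((hF k).toLip D Ω : Lip D Ω) : H D Ω)) atTop (𝓝 f))
    {S : Set (GPt n m)} (hSΩ : S ⊆ Ω.carrier) (hSne : S.Nonempty) {L : ℝ} {η : GPt n m → ℝ}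
    (hη : IsCutoff D.lam S L η) {β N : ℝ} (hβ : 1 ≤ β) (hN : 0 < N) :
    ∃ c : ℕ → ℝ, Tendsto c atTop (𝓝 0) ∧
      ∀ k, energy ((hF k).toLip D Ω)
        ((isBddLip_testFun hη.isBddLip (hF k) hβ hN.le).toLip D Ω) ≤ c k := by
  set T := 1 + ‖(tilde : H D Ω →L[ℝ] L2u D Ω)‖ ^ 2 with hT
  set C := (β * N ^ (β - 1)) ^ 4 * (3 + 8 * L) with hC
  have hL := hη.L_nonneg hSne
  have hT0 : 0 ≤ T := by positivity
  refine ⟨fun k => T * (‖(((hF k).toLip D Ω : Lip D Ω) : H D Ω) - f‖ *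
    (√C * ‖(((hF k).toLip D Ω : Lip D Ω) : H D Ω)‖)), ?_, fun k => ?_⟩
  · have h1 : Tendsto (fun k => ‖(((hF k).toLip D Ω : Lip D Ω) : H D Ω) - f‖) atTop (𝓝 0) :=
      tendsto_iff_norm_sub_tendsto_zero.1 hlim
    have := (h1.mul (hlim.norm.const_mul √C)).const_mul T
    simpa using this
  · have hθ := isBddLip_testFun hη.isBddLip (hF k) hβ hN.le
    set θ := hθ.toLip D Ω with hθd
    have hle : a0 f (θ : H D Ω) ≤ 0 := by
      refine hf _ (subset_closure ⟨θ, ?_, rfl⟩) ⟨fun _ => θ, fun _ z _ => hθ.nonneg z,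
        tendsto_const_nhds⟩
      obtain ⟨K, hK, hKS, hK0⟩ := hη.support
      refine ⟨K, hK, hKS.trans hSΩ, fun z _ hz => ?_⟩
      change η z ^ 2 * truncSq β N (F k z) = 0
      rw [hK0 z hz]; ring
    have hn : ‖θ‖ ≤ √C * ‖(hF k).toLip D Ω‖ := by
      have := Real.sqrt_le_sqrt (norm_testFun_le (D := D) (Ω := Ω) hSne hη (hF k) hβ hN)
      rwa [Real.sqrt_sq (norm_nonneg _), Real.sqrt_mul (by positivity),
        Real.sqrt_sq (norm_nonneg _)] at this
    have h1 : a0 (((hF k).toLip D Ω : Lip D Ω) : H D Ω) (θ : H D Ω) =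
        a0 f (θ : H D Ω) + a0 ((((hF k).toLip D Ω : Lip D Ω) : H D Ω) - f) (θ : H D Ω) := by
      rw [← a0_add_left, add_sub_cancel]
    rw [← a0_coe, h1]
    refine (add_le_of_nonpos_left hle).trans ((a0_le _ _).trans ?_)
    rw [UniformSpace.Completion.norm_coe]
    simp only [UniformSpace.Completion.norm_coe]
    gcongr

/-! ### The Sobolev inequality on rectangles -/

theorem lintegral_restrict_of_support {μ : Measure (GPt n m)} {Q B : Set (GPt n m)}
    (hQ : MeasurableSet Q) (hQB : Q ⊆ B) {φ : GPt n m → ℝ≥0∞} (hφ : ∀ z ∉ Q, φ z = 0) :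
    ∫⁻ z in B, φ z ∂μ = ∫⁻ z in Q, φ z ∂μ := by
  have e : φ = Q.indicator φ := (indicator_eq_self.2 fun z hz => by
    by_contra h; exact hz (hφ z h)).symm
  conv_lhs => rw [e]
  rw [lintegral_indicator hQ, Measure.restrict_restrict hQ, inter_eq_self_of_subset_left hQB]

theorem integral_restrict_of_support {μ : Measure (GPt n m)} {Q B : Set (GPt n m)}
    (hQ : MeasurableSet Q) (hQB : Q ⊆ B) {φ : GPt n m → ℝ} (hφ : ∀ z ∉ Q, φ z = 0) :
    ∫ z in B, φ z ∂μ = ∫ z in Q, φ z ∂μ := by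
  have e : φ = Q.indicator φ := (indicator_eq_self.2 fun z hz => by
    by_contra h; exact hz (hφ z h)).symm
  conv_lhs => rw [e]
  rw [integral_indicator hQ, Measure.restrict_restrict hQ, inter_eq_self_of_subset_left hQB]

theorem integral_weightMeasure {w : GPt n m → ℝ} (hw : IsWeight w) {S : Set (GPt n m)}
    (hS : MeasurableSet S) (φ : GPt n m → ℝ) :
    ∫ z in S, φ z ∂(weightMeasure w) = ∫ z in S, φ z * w z := by
  rw [weightMeasure, restrict_withDensity hS, integral_withDensity_eq_integral_toReal_smul₀
    hw.locallyIntegrable.aestronglyMeasurable.aemeasurable.ennreal_ofReal.restrict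
    (Eventually.of_forall fun z => ENNReal.ofReal_lt_top)]
  refine integral_congr_ae (Eventually.of_forall fun z => ?_)
  simp only [ENNReal.toReal_ofReal (hw.nonneg z), smul_eq_mul, mul_comm]

/-- On a probability space, the `L^q` norm is controlled by the oscillation and the `L²` norm. -/
theorem eLpNorm_le_oscillation_add {α : Type*} [MeasurableSpace α] {ν : Measure α}
    [IsProbabilityMeasure ν] {g : α → ℝ} (hg : AEStronglyMeasurable g ν) {M : ℝ}
    (hM : ∀ z, |g z| ≤ M) {q : ℝ} (hq : 2 ≤ q) :
    eLpNorm g (ENNReal.ofReal q) ν ≤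
      ENNReal.ofReal ((∫ z, |g z - ∫ w, g w ∂ν| ^ q ∂ν) ^ (1 / q)) + eLpNorm g 2 ν := by
  set a := ∫ w, g w ∂ν with ha
  have hq0 : 0 < q := by linarith
  have hmem : MemLp (fun z => g z - a) (ENNReal.ofReal q) ν := by
    refine MemLp.of_bound (hg.sub aestronglyMeasurable_const) (M + |a|)
      (Eventually.of_forall fun z => ?_)
    exact (abs_sub _ _).trans (add_le_add_left (hM z) _)
  have hq1 : 1 ≤ ENNReal.ofReal q := by
    rw [← ENNReal.ofReal_one]; exact ENNReal.ofReal_le_ofReal (by linarith)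
  have h1 : eLpNorm g (ENNReal.ofReal q) ν ≤
      eLpNorm (fun z => g z - a) (ENNReal.ofReal q) ν + eLpNorm (fun _ => a) (ENNReal.ofReal q) ν := by
    have := eLpNorm_add_le hmem.1 (aestronglyMeasurable_const (b := a)) hq1
    refine le_trans (le_of_eq ?_) this
    congr 1
    funext z
    simp
  have h2 : eLpNorm (fun z => g z - a) (ENNReal.ofReal q) ν =
      ENNReal.ofReal ((∫ z, |g z - a| ^ q ∂ν) ^ (1 / q)) := by
    rw [hmem.eLpNorm_eq_integral_rpow_norm (by positivity) ENNReal.ofReal_ne_top,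
      ENNReal.toReal_ofReal hq0.le, one_div]
    rfl
  have h3 : eLpNorm (fun _ : α => a) (ENNReal.ofReal q) ν ≤ eLpNorm g 2 ν := by
    rw [eLpNorm_const _ (by simpa using hq0) (IsProbabilityMeasure.ne_zero ν)]
    simp only [measure_univ, ENNReal.one_rpow, mul_one]
    calc ‖a‖ₑ ≤ ∫⁻ z, ‖g z‖ₑ ∂ν := enorm_integral_le_lintegral_enorm _
      _ = eLpNorm g 1 ν := eLpNorm_one_eq_lintegral_enorm.symm
      _ ≤ eLpNorm g 2 ν := eLpNorm_le_eLpNorm_of_exponent_le one_le_two hg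
  rw [← h2]
  exact h1.trans (add_le_add_right h3 _)

/-- The Poincaré inequality is applied on the ball of radius `8h`, which contains the rectangle. As
`g` vanishes off the rectangle, all integrals shrink back to it. The mean of `g` is not removed but
estimated by its `L²` average, which gives the second term on the right. -/
theorem sobolev_rect (hn : 1 ≤ n) (D : Operator n m) {C₃ C₄ C₅ q : ℝ} (hC₅ : 0 < C₅) (hq : 2 < q)
    (hu : WeightDoubling D.lam D.u C₃) (hv : WeightDoubling D.lam D.v C₄)
    (hP : SobolevPoincare D.lam D.u D.v q C₅) (z₀ : GPt n m) {h : ℝ} (hh : 0 < h)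
    {g : GPt n m → ℝ} (hg : IsBddLip g)
    (hsupp : ∃ K, IsCompact K ∧ K ⊆ rect D.lam z₀ h ∧ ∀ z ∉ K, g z = 0) :
    ((weightMeasure D.u (rect D.lam z₀ h))⁻¹ *
        ∫⁻ z in rect D.lam z₀ h, ENNReal.ofReal (g z) ^ q ∂(weightMeasure D.u)) ^ (1 / q) ≤
      ENNReal.ofReal (max 1 C₃) ^ 3 *
        (ENNReal.ofReal (C₅ * (8 * h) * ((weightMeasure D.v (rect D.lam z₀ h)).toReal⁻¹ *
          ∫ z in rect D.lam z₀ h, gradSq D.lam g z * D.v z) ^ (1 / 2 : ℝ)) +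
        ((weightMeasure D.u (rect D.lam z₀ h))⁻¹ *
          ∫⁻ z in rect D.lam z₀ h, ENNReal.ofReal (g z) ^ (2 : ℝ) ∂(weightMeasure D.u)) ^
            (1 / 2 : ℝ)) := by
  obtain ⟨K, hK, hKQ, hK0⟩ := hsupp
  obtain ⟨M, hM⟩ := hg.bdd
  set Q := rect D.lam z₀ h with hQd
  set B := rhoBall D.lam z₀ (8 * h) with hBd
  set U := weightMeasure D.u with hU
  set V := weightMeasure D.v with hV
  have hl := D.lam_admissible
  have hQm : MeasurableSet Q := measurableSet_rect _ _ _
  have hQB : Q ⊆ B := rect_subset_rhoBall_eight z₀ hh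
  have hBbd : Bornology.IsBounded B :=
    (rectDomain D.lam z₀ (8 * h)).isBounded.subset (rhoBall_subset_rect hn hl z₀ (8 * h))
  have hUQ : 0 < U Q := weightMeasure_rect_pos hn hl D.u_weight hu z₀ hh
  have hVQ : 0 < V Q := weightMeasure_rect_pos hn hl D.v_weight hv z₀ hh
  have hUB : U B < ∞ := weightMeasure_lt_top D.u_weight hBbd
  have hVB : V B < ∞ := weightMeasure_lt_top D.v_weight hBbd
  have hUB0 : 0 < U B := hUQ.trans_le (measure_mono hQB)
  have hgoff : ∀ z ∉ Q, g z = 0 := fun z hz => hK0 z fun hzK => hz (hKQ hzK)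
  have hgradoff : ∀ z ∉ Q, gradSq D.lam g z = 0 := fun z hz => by
    have : ∀ i, pderiv i g z = 0 := fun i =>
      pderiv_eq_zero_of_notMem hK.isClosed hK0 i fun hzK => hz (hKQ hzK)
    simp [gradSq, this]
  have hν : IsProbabilityMeasure ((U B)⁻¹ • U.restrict B) := ⟨by
    simp [ENNReal.inv_mul_cancel hUB0.ne' hUB.ne]⟩
  have hgm : AEStronglyMeasurable g ((U B)⁻¹ • U.restrict B) :=
    hg.lipschitz.choose_spec.continuous.aestronglyMeasurable
  have key := eLpNorm_le_oscillation_add (ν := (U B)⁻¹ • U.restrict B) hgm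
    (M := M) (fun z => by rw [abs_of_nonneg (hg.nonneg z)]; exact hM z) hq.le
  have hav : ∀ φ : GPt n m → ℝ, ⨍ z in B, φ z ∂U = ∫ z, φ z ∂((U B)⁻¹ • U.restrict B) := by
    intro φ
    rw [average, Measure.restrict_apply_univ]
  have hPB := hP g hg.lipschitz z₀ (8 * h) (by linarith)
  simp only [← hBd, ← hU, ← hV, hav] at hPB
  -- Here enlarging the domain helps: `v(B)⁻¹ ≤ v(Q)⁻¹`. The reverse comparison, which needs
  -- doubling, is required only for `u` on the left side.
  have hgrad : ⨍ z in B, gradSq D.lam g z ∂V ≤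
      (V Q).toReal⁻¹ * ∫ z in Q, gradSq D.lam g z * D.v z := by
    rw [setAverage_eq, integral_restrict_of_support hQm hQB hgradoff,
      hV, integral_weightMeasure D.v_weight hQm, smul_eq_mul]
    refine mul_le_mul_of_nonneg_right ?_ (integral_nonneg fun z =>
      mul_nonneg (gradSq_nonneg _ _ _) (D.v_weight.nonneg z))
    have h1 : (V Q).toReal ≤ (V B).toReal := ENNReal.toReal_mono hVB.ne (measure_mono hQB)
    have h2 : 0 < (V Q).toReal :=
      ENNReal.toReal_pos hVQ.ne' (weightMeasure_rect_lt_top D.v_weight _ _ _).ne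
    exact inv_anti₀ h2 h1
  have hgrad0 : 0 ≤ ⨍ z in B, gradSq D.lam g z ∂V := by
    rw [setAverage_eq]
    exact smul_nonneg (by positivity) (integral_nonneg fun z => gradSq_nonneg _ _ _)
  have hR := hPB.trans (mul_le_mul_of_nonneg_left
    (Real.rpow_le_rpow hgrad0 hgrad (by norm_num : (0 : ℝ) ≤ 1 / 2)) (by positivity))
  have hnorm : ∀ r : ℝ, 0 < r → eLpNorm g (ENNReal.ofReal r) ((U B)⁻¹ • U.restrict B) =
      ((U B)⁻¹ * ∫⁻ z in Q, ENNReal.ofReal (g z) ^ r ∂U) ^ (1 / r) := by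
    intro r hr
    rw [eLpNorm_eq_lintegral_rpow_enorm_toReal (by simpa using hr) ENNReal.ofReal_ne_top,
      ENNReal.toReal_ofReal hr.le, lintegral_smul_measure, smul_eq_mul]
    congr 2
    have e : ∀ z, ‖g z‖ₑ = ENNReal.ofReal (g z) := fun z => by
      rw [Real.enorm_eq_ofReal (hg.nonneg z)]
    simp only [e]
    refine lintegral_restrict_of_support hQm hQB fun z hz => ?_
    rw [hgoff z hz, ENNReal.ofReal_zero, ENNReal.zero_rpow_of_pos hr]
  have hnorm2 := hnorm 2 two_pos
  rw [ENNReal.ofReal_ofNat] at hnorm2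
  rw [hnorm q (by linarith), hnorm2] at key
  set c := ENNReal.ofReal (max 1 C₃) ^ 3 with hc
  have hc1 : 1 ≤ c := by
    refine one_le_pow₀ ?_
    rw [← ENNReal.ofReal_one]
    exact ENNReal.ofReal_le_ofReal (le_max_left _ _)
  have hcB : U B ≤ c * U Q := (weightMeasure_rhoBall_le hn hl hu z₀ hh).trans
    (mul_le_mul_left (pow_le_pow_left₀ (zero_le)
      (ENNReal.ofReal_le_ofReal (le_max_right _ _)) 3) _)
  have hctop : c ≠ ∞ := ENNReal.pow_ne_top ENNReal.ofReal_ne_top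
  have hinv : (U Q)⁻¹ ≤ c * (U B)⁻¹ := by
    have h1 : (c * U Q)⁻¹ ≤ (U B)⁻¹ := ENNReal.inv_le_inv.2 hcB
    rw [ENNReal.mul_inv (Or.inl (by positivity)) (Or.inl hctop)] at h1
    calc (U Q)⁻¹ = c * (c⁻¹ * (U Q)⁻¹) := by
          rw [← mul_assoc, ENNReal.mul_inv_cancel (by positivity) hctop, one_mul]
      _ ≤ c * (U B)⁻¹ := mul_le_mul_right h1 _
  calc ((U Q)⁻¹ * ∫⁻ z in Q, ENNReal.ofReal (g z) ^ q ∂U) ^ (1 / q)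
      ≤ (c * ((U B)⁻¹ * ∫⁻ z in Q, ENNReal.ofReal (g z) ^ q ∂U)) ^ (1 / q) := by
        rw [← mul_assoc]
        exact ENNReal.rpow_le_rpow (mul_le_mul_left hinv _) (by positivity)
    _ = c ^ (1 / q) * ((U B)⁻¹ * ∫⁻ z in Q, ENNReal.ofReal (g z) ^ q ∂U) ^ (1 / q) :=
        ENNReal.mul_rpow_of_nonneg _ _ (by positivity)
    _ ≤ c * (_ + _) := by
        refine mul_le_mul' ?_ (key.trans (add_le_add (ENNReal.ofReal_le_ofReal hR) ?_))
        -- Since `c ≥ 1` and `1/q ≤ 1`, the root of the doubling constant is bounded by the constant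
        -- itself.
        · calc c ^ (1 / q) ≤ c ^ (1 : ℝ) := ENNReal.rpow_le_rpow_of_exponent_le hc1
                (by rw [div_le_one (by linarith)]; linarith)
            _ = c := ENNReal.rpow_one _
        · exact ENNReal.rpow_le_rpow (mul_le_mul_left
            (ENNReal.inv_le_inv.2 (measure_mono hQB)) _) (by norm_num)

/-! ### The reverse Hölder inequality -/

/-- The transition ends at the midpoint of `r` and `R`, so that the support is a compact subset of
the open larger rectangle. This is the source of the factor `2`. Both boxes use `Λ(z₀, R)`, and the
smaller one still covers `Q(z₀, r)` because `Λ` is monotone. -/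
theorem exists_isCutoff_rect (hn : 1 ≤ n) {lam : EuclideanSpace ℝ (Fin n) → ℝ}
    (hl : IsAdmissible lam) (z₀ : GPt n m) {r R : ℝ} (hr : 0 < r) (hrR : r < R) :
    ∃ η, IsCutoff lam (rect lam z₀ R) ((n + m) * (2 / (R - r)) ^ 2) η ∧
      ∀ z ∈ rect lam z₀ r, η z = 1 := by
  have hR : 0 < R := hr.trans hrR
  have hΛ := Lam_pos hn hl z₀ hR
  have hab : r < (r + R) / 2 := by linarith
  refine ⟨cutoff z₀ (Lam lam z₀ R) r ((r + R) / 2), ⟨lipschitzWith_cutoff hΛ hab,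
    cutoff_nonneg _ _ _ _, cutoff_le_one _ _ _ _, ⟨_, isCompact_closedBox z₀ (Lam lam z₀ R)
      ((r + R) / 2), ?_, fun z hz => cutoff_eq_zero hΛ hab hz⟩, fun z hz => ?_⟩, fun z hz => ?_⟩
  · rintro z ⟨h1, h2⟩
    rw [Metric.mem_closedBall, dist_eq_norm] at h1 h2
    exact ⟨by linarith, h2.trans_lt (mul_lt_mul_of_pos_right (by linarith) hΛ)⟩
  · refine (gradSq_cutoff_le hΛ hab (hl.nonneg _) (le_Lam hl.continuous hz.1)).trans_eq ?_
    congr 2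
    rw [show (r + R) / 2 - r = (R - r) / 2 by ring, inv_div]
  · exact cutoff_eq_one hΛ hab hz.1.le (hz.2.le.trans
      (mul_le_mul_of_nonneg_left (Lam_mono hl.continuous hr hrR.le) hr.le))

/-- Fatou's lemma. It serves both limits, `k → ∞` in the approximation and `N → ∞` in the
truncation, and asks for no finiteness of the limit integral. -/
theorem lintegral_rpow_le_of_tendsto {α : Type*} [MeasurableSpace α] {μ : Measure α}
    {φ : ℕ → α → ℝ≥0∞} {ψ : α → ℝ≥0∞} (hφ : ∀ k, AEMeasurable (φ k) μ)
    (hψ : ∀ᵐ z ∂μ, Tendsto (fun k => φ k z) atTop (𝓝 (ψ z))) {q : ℝ} (hq : 0 < q)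
    {c : ℝ≥0∞} {R : ℕ → ℝ≥0∞} {R' : ℝ≥0∞} (hR : Tendsto R atTop (𝓝 R'))
    (h : ∀ k, (c * ∫⁻ z, φ k z ∂μ) ^ (1 / q) ≤ R k) : (c * ∫⁻ z, ψ z ∂μ) ^ (1 / q) ≤ R' := by
  rw [one_div, ENNReal.rpow_inv_le_iff hq]
  have h' : ∀ k, c * ∫⁻ z, φ k z ∂μ ≤ R k ^ q := fun k => by
    have := h k
    rwa [one_div, ENNReal.rpow_inv_le_iff hq] at this
  rw [← smul_eq_mul, ← lintegral_smul_measure]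
  have hac : c • μ ≪ μ := Measure.smul_absolutelyContinuous
  calc ∫⁻ z, ψ z ∂(c • μ) = ∫⁻ z, liminf (fun k => φ k z) atTop ∂(c • μ) := by
        refine lintegral_congr_ae (hac.ae_le ?_)
        filter_upwards [hψ] with z hz using hz.liminf_eq.symm
    _ ≤ liminf (fun k => ∫⁻ z, φ k z ∂(c • μ)) atTop :=
        lintegral_liminf_le' fun k => (hφ k).mono_ac hac
    _ ≤ liminf (fun k => R k ^ q) atTop := by
        refine liminf_le_liminf (Eventually.of_forall fun k => ?_)
        rw [lintegral_smul_measure]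
        exact h' k
    _ = R' ^ q := ((ENNReal.continuous_rpow_const.tendsto R').comp hR).liminf_eq

theorem eLpNorm_two_eq {α : Type*} [MeasurableSpace α] {μ : Measure α} {φ : α → ℝ}
    (hφ : ∀ᵐ z ∂μ, 0 ≤ φ z) :
    eLpNorm φ 2 μ = (∫⁻ z, ENNReal.ofReal (φ z) ^ (2 : ℝ) ∂μ) ^ (1 / 2 : ℝ) := by
  rw [eLpNorm_eq_lintegral_rpow_enorm_toReal two_ne_zero ENNReal.ofNat_ne_top,
    ENNReal.toReal_ofNat]
  congr 1
  refine lintegral_congr_ae ?_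
  filter_upwards [hφ] with z hz
  rw [Real.enorm_eq_ofReal hz]

theorem integral_sq_weight_le {w : GPt n m → ℝ} (hw : IsWeight w) {S : Set (GPt n m)}
    (hS : MeasurableSet S) {φ : GPt n m → ℝ} (hφm : AEStronglyMeasurable φ
      ((weightMeasure w).restrict S)) {y : ℝ} (hy : 0 ≤ y)
    (h : eLpNorm φ 2 ((weightMeasure w).restrict S) ≤ ENNReal.ofReal y) :
    ∫ z in S, φ z ^ 2 * w z ≤ y ^ 2 := by
  rw [← integral_weightMeasure hw hS fun z => φ z ^ 2]
  have hm : MemLp φ 2 ((weightMeasure w).restrict S) := ⟨hφm, h.trans_lt ENNReal.ofReal_lt_top⟩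
  have h1 := hm.eLpNorm_eq_integral_rpow_norm two_ne_zero ENNReal.ofNat_ne_top
  rw [h1] at h
  simp only [ENNReal.toReal_ofNat, Real.rpow_ofNat, Real.norm_eq_abs, sq_abs] at h
  have h2 := (ENNReal.ofReal_le_ofReal_iff hy).1 h
  have h0 : 0 ≤ ∫ z in S, φ z ^ 2 ∂(weightMeasure w) := integral_nonneg fun z => sq_nonneg _
  rw [show (2 : ℝ)⁻¹ = 1 / 2 by norm_num, ← Real.sqrt_eq_rpow] at h2
  exact (Real.sqrt_le_left hy).1 h2

/-! ### One step of the iteration, from exponent `2β` to exponent `qβ`. -/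

section

variable {C₃ C₄ C₅ q : ℝ} (hn : 1 ≤ n) (hC₅ : 0 < C₅) (hq : 2 < q)
  (hu : WeightDoubling D.lam D.u C₃) (hv : WeightDoubling D.lam D.v C₄)
  (hP : SobolevPoincare D.lam D.u D.v q C₅)
  {z₀ : GPt n m} {r R h : ℝ} (hr : 0 < r) (hrR : r < R) (hRh : R ≤ h)

include hn hC₅ hq hu hv hP hr hrR hRh in
-- Caccioppoli and Sobolev are combined for one Lipschitz function. The number `c` is its defect
-- from being a subsolution. An upper bound `y` replaces the `L²` norm so that the estimate survives
-- small perturbations of `F`.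
theorem truncPow_step_lipschitz {L : ℝ} {η : GPt n m → ℝ}
    (hη : IsCutoff D.lam (rect D.lam z₀ R) L η) (hη1 : ∀ z ∈ rect D.lam z₀ r, η z = 1)
    {F : GPt n m → ℝ} (hF : IsBddLip F) {β N c y : ℝ} (hβ : 1 ≤ β) (hN : 0 < N) (hy : 0 ≤ y)
    (hc : energy (hF.toLip D (rectDomain D.lam z₀ h))
      ((isBddLip_testFun hη.isBddLip hF hβ hN.le).toLip D (rectDomain D.lam z₀ h)) ≤ c)
    (hFy : eLpNorm (fun z => truncPow β N (F z)) 2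
      ((weightMeasure D.u).restrict (rect D.lam z₀ R)) ≤ ENNReal.ofReal y) :
    ((weightMeasure D.u (rect D.lam z₀ h))⁻¹ * ∫⁻ z in rect D.lam z₀ r,
        ENNReal.ofReal (truncPow β N (F z)) ^ q ∂(weightMeasure D.u)) ^ (1 / q) ≤
      ENNReal.ofReal (max 1 C₃) ^ 3 *
        (ENNReal.ofReal (C₅ * (8 * h) * ((weightMeasure D.v (rect D.lam z₀ h)).toReal⁻¹ *
          (4 * c + 10 * β ^ 2 * L * y ^ 2)) ^ (1 / 2 : ℝ)) +
        (weightMeasure D.u (rect D.lam z₀ h))⁻¹ ^ (1 / 2 : ℝ) * ENNReal.ofReal y) := by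
  have hl := D.lam_admissible
  have hR : 0 < R := hr.trans hrR
  have hh : 0 < h := hR.trans_le hRh
  have hRQ : rect D.lam z₀ R ⊆ rect D.lam z₀ h := rect_mono hl hR hRh
  have hrR' : rect D.lam z₀ r ⊆ rect D.lam z₀ R := rect_mono hl hr hrR.le
  have hne : (rect D.lam z₀ R).Nonempty :=
    ⟨z₀, by simpa using hR, by simpa using mul_pos hR (Lam_pos hn hl z₀ hR)⟩
  have hL : 0 ≤ L := hη.L_nonneg hne
  have hH := hF.truncPow hβ hN.le
  have hg := hη.isBddLip.mul hH
  obtain ⟨K, hK, hKR, hK0⟩ := hη.support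
  have hS := sobolev_rect hn D hC₅ hq hu hv hP z₀ hh hg
    ⟨K, hK, hKR.trans hRQ, fun z hz => by rw [hK0 z hz, zero_mul]⟩
  refine le_trans ?_ (hS.trans (mul_le_mul_right (add_le_add ?_ ?_) _))
  · refine ENNReal.rpow_le_rpow (mul_le_mul_right ?_ _) (by positivity)
    refine le_trans ?_ (lintegral_mono_set (hrR'.trans hRQ))
    refine setLIntegral_mono' (measurableSet_rect _ _ _) fun z hz => ?_
    rw [hη1 z hz, one_mul]
  · refine ENNReal.ofReal_le_ofReal (mul_le_mul_of_nonneg_left (Real.rpow_le_rpow ?_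
      (mul_le_mul_of_nonneg_left ?_ (by positivity)) (by norm_num)) (by positivity))
    · exact mul_nonneg (by positivity) (integral_nonneg fun z =>
        mul_nonneg (gradSq_nonneg _ _ _) (D.v_weight.nonneg z))
    · refine (integral_gradSq_le (Ω := rectDomain D.lam z₀ h) (measurableSet_rect _ _ _) hRQ hη hF
        hβ hN).trans (add_le_add (mul_le_mul_of_nonneg_left hc (by norm_num))
          (mul_le_mul_of_nonneg_left ?_ (by positivity)))
      exact integral_sq_weight_le D.u_weight (measurableSet_rect _ _ _)
        hH.lipschitz.choose_spec.continuous.aestronglyMeasurable hy hFy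
  · rw [ENNReal.mul_rpow_of_nonneg _ _ (by norm_num)]
    refine mul_le_mul_right (le_trans ?_ hFy) _
    rw [eLpNorm_two_eq (Eventually.of_forall hH.nonneg)]
    refine ENNReal.rpow_le_rpow ?_ (by norm_num)
    rw [lintegral_restrict_of_support (measurableSet_rect _ _ _) hRQ fun z hz => by
      rw [hK0 z fun hzK => hz (hKR hzK)]; simp]
    refine lintegral_mono fun z => ENNReal.rpow_le_rpow (ENNReal.ofReal_le_ofReal ?_) (by norm_num)
    exact mul_le_of_le_one_left (hH.nonneg z) (hη.le_one z)

include hn hC₅ hq hu hv hP hr hrR hRh in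
-- The limit `k → ∞` of `truncPow_step_lipschitz`. For fixed `N` the truncated power is Lipschitz,
-- so `H(F_k)` converges in `L²` on the right, while Fatou handles the left. The term `4 * 0` is the
-- limit of the defects.
theorem truncPow_step {f : H D (rectDomain D.lam z₀ h)} (hf : IsNonneg f) (hfs : IsSubsolution f)
    {β N : ℝ} (hβ : 1 ≤ β) (hN : 0 < N) :
    ∃ y : ℝ, 0 ≤ y ∧ eLpNorm (fun z => truncPow β N (tilde f z)) 2
        ((weightMeasure D.u).restrict (rect D.lam z₀ R)) = ENNReal.ofReal y ∧
      ((weightMeasure D.u (rect D.lam z₀ h))⁻¹ * ∫⁻ z in rect D.lam z₀ r,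
          ENNReal.ofReal (truncPow β N (tilde f z)) ^ q ∂(weightMeasure D.u)) ^ (1 / q) ≤
        ENNReal.ofReal (max 1 C₃) ^ 3 *
          (ENNReal.ofReal (C₅ * (8 * h) * ((weightMeasure D.v (rect D.lam z₀ h)).toReal⁻¹ *
            (4 * 0 + 10 * β ^ 2 * ((n + m) * (2 / (R - r)) ^ 2) * y ^ 2)) ^ (1 / 2 : ℝ)) +
          (weightMeasure D.u (rect D.lam z₀ h))⁻¹ ^ (1 / 2 : ℝ) * ENNReal.ofReal y) := by
  have hl := D.lam_admissible
  have hR : 0 < R := hr.trans hrR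
  have hh : 0 < h := hR.trans_le hRh
  have hRQ : rect D.lam z₀ R ⊆ rect D.lam z₀ h := rect_mono hl hR hRh
  have hrQ : rect D.lam z₀ r ⊆ rect D.lam z₀ h := rect_mono hl hr (hrR.le.trans hRh)
  have hne : (rect D.lam z₀ R).Nonempty :=
    ⟨z₀, by simpa using hR, by simpa using mul_pos hR (Lam_pos hn hl z₀ hR)⟩
  obtain ⟨F, hF, hlim, hae, hL2⟩ := hf.exists_seq
  obtain ⟨η, hη, hη1⟩ := exists_isCutoff_rect hn hl z₀ hr hrR
  obtain ⟨c, hct, hc⟩ := hfs.energy_testFun_le hF hlim hRQ hne hη hβ hN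
  set U := weightMeasure D.u with hU
  have hLip := lipschitzWith_truncPow hβ hN.le
  set M := Real.toNNReal (β * N ^ (β - 1)) with hM
  have hle : U.restrict (rect D.lam z₀ R) ≤ U.restrict (rectDomain D.lam z₀ h).carrier :=
    Measure.restrict_mono hRQ le_rfl
  have hmem : MemLp (tilde f) 2 (U.restrict (rectDomain D.lam z₀ h).carrier) := Lp.memLp _
  have hδfin : ∀ k, eLpNorm (fun z => F k z - tilde f z) 2
      (U.restrict (rectDomain D.lam z₀ h).carrier) ≠ ∞ := fun k =>
    ((lip_memLp ((hF k).toLip D (rectDomain D.lam z₀ h))).sub hmem).2.ne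
  have hHmem : MemLp (fun z => truncPow β N (tilde f z)) 2 (U.restrict (rect D.lam z₀ R)) :=
    (hLip.comp_memLp truncPow_zero hmem).mono_measure hle
  set y := (eLpNorm (fun z => truncPow β N (tilde f z)) 2 (U.restrict (rect D.lam z₀ R))).toReal
    with hyd
  have hy : eLpNorm (fun z => truncPow β N (tilde f z)) 2 (U.restrict (rect D.lam z₀ R)) =
      ENNReal.ofReal y := (ENNReal.ofReal_toReal hHmem.2.ne).symm
  have hy0 : 0 ≤ y := ENNReal.toReal_nonneg
  refine ⟨y, hy0, hy, ?_⟩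
  set δ : ℕ → ℝ := fun k => (eLpNorm (fun z => F k z - tilde f z) 2
    (U.restrict (rectDomain D.lam z₀ h).carrier)).toReal with hδ
  have hδ0 : Tendsto δ atTop (𝓝 0) := by
    have := (ENNReal.tendsto_toReal ENNReal.zero_ne_top).comp hL2
    rwa [ENNReal.toReal_zero] at this
  -- The triangle inequality, with the distance from `H(F_k)` to `H(f̃)` controlled by the Lipschitz
  -- constant `M` of `H`.
  have hyk : ∀ k, eLpNorm (fun z => truncPow β N (F k z)) 2 (U.restrict (rect D.lam z₀ R)) ≤
      ENNReal.ofReal (y + M * δ k) := by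
    intro k
    have hHk : AEStronglyMeasurable (fun z => truncPow β N (F k z))
        (U.restrict (rect D.lam z₀ R)) :=
      ((hF k).truncPow hβ hN.le).lipschitz.choose_spec.continuous.aestronglyMeasurable
    have h1 := eLpNorm_add_le hHmem.1 (hHk.sub hHmem.1) one_le_two
    rw [add_sub_cancel] at h1
    refine h1.trans ?_
    rw [ENNReal.ofReal_add hy0 (by positivity), hy]
    refine add_le_add_right ?_ _
    rw [ENNReal.ofReal_mul M.coe_nonneg, ENNReal.ofReal_coe_nnreal, hδ, ENNReal.ofReal_toReal (hδfin k)]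
    refine le_trans (eLpNorm_le_nnreal_smul_eLpNorm_of_ae_le_mul
      (g := fun z => F k z - tilde f z) (c := M) (Eventually.of_forall fun z => ?_) 2) ?_
    · have := hLip.dist_le_mul (F k z) (tilde f z)
      rw [dist_eq_norm, dist_eq_norm] at this
      exact this
    · rw [ENNReal.smul_def, smul_eq_mul]
      exact mul_le_mul_right (eLpNorm_mono_measure _ hle) _
  have hstep := fun k => truncPow_step_lipschitz hn hC₅ hq hu hv hP hr hrR hRh hη hη1 (hF k) hβ hN
    (add_nonneg ENNReal.toReal_nonneg (mul_nonneg M.2 ENNReal.toReal_nonneg)) (hc k) (hyk k)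
  have hUtop : (U (rect D.lam z₀ h))⁻¹ ^ (1 / 2 : ℝ) ≠ ∞ :=
    ENNReal.rpow_ne_top_of_nonneg (by norm_num)
      (ENNReal.inv_ne_top.2 (weightMeasure_rect_pos hn hl D.u_weight hu z₀ hh).ne')
  have hyt : Tendsto (fun k => y + M * δ k) atTop (𝓝 y) := by
    simpa using (hδ0.const_mul (M : ℝ)).const_add y
  refine lintegral_rpow_le_of_tendsto (fun k => ?_) ?_ (by linarith) ?_ hstep
  · have := ((hF k).truncPow hβ hN.le).lipschitz.choose_spec.continuous.measurable
    exact (this.ennreal_ofReal.pow_const q).aemeasurable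
  · filter_upwards [ae_mono (Measure.restrict_mono hrQ le_rfl) hae] with z hz
    exact (ENNReal.continuous_rpow_const.tendsto _).comp
      ((ENNReal.continuous_ofReal.tendsto _).comp ((hLip.continuous.tendsto _).comp hz))
  · refine ENNReal.Tendsto.const_mul ?_ (Or.inr (ENNReal.pow_ne_top ENNReal.ofReal_ne_top))
    refine Tendsto.add ?_ (ENNReal.Tendsto.const_mul
      ((ENNReal.continuous_ofReal.tendsto _).comp hyt) (Or.inr hUtop))
    refine (ENNReal.continuous_ofReal.tendsto _).comp (Tendsto.const_mul _ ?_)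
    refine ((Real.continuous_rpow_const (by norm_num)).tendsto _).comp (Tendsto.const_mul _ ?_)
    exact (hct.const_mul 4).add ((hyt.pow 2).const_mul _)

include hn in
theorem one_le_muRatio (D : Operator n m) {Q : Set (GPt n m)}
    (hU0 : weightMeasure D.u Q ≠ 0) (hUt : weightMeasure D.u Q ≠ ∞) : 1 ≤ muRatio D Q := by
  have h1 : weightMeasure D.v Q ≤ weightMeasure D.u Q := weightMeasure_v_le hn D Q
  unfold muRatio
  calc (1 : ℝ≥0∞) = weightMeasure D.u Q ^ (1 / 2 : ℝ) * weightMeasure D.u Q ^ (-(1 / 2) : ℝ) := by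
        rw [← ENNReal.rpow_add _ _ hU0 hUt]; simp
    _ ≤ _ := by
        refine mul_le_mul_right ?_ _
        rw [ENNReal.rpow_neg, ENNReal.rpow_neg]
        exact ENNReal.inv_le_inv.2 (ENNReal.rpow_le_rpow h1 (by norm_num))

/-- The constant of the reverse Hölder inequality. -/
def stepConst (n m : ℕ) (C₃ C₅ : ℝ) : ℝ := max 1 C₃ ^ 3 * (C₅ * 16 * √(10 * (n + m)) + 1)

include hn hC₅ hq hu hv hP hr hrR hRh in
-- The bound obtained at level `N` does not involve `N` once `H(t) ≤ t^β` is used on the right. On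
-- the left the truncated power is eventually equal to `t^β` at each point, and Fatou's lemma
-- concludes.
theorem reverse_holder {f : H D (rectDomain D.lam z₀ h)} (hf : IsNonneg f) (hfs : IsSubsolution f)
    {β : ℝ} (hβ : 1 ≤ β) :
    ((weightMeasure D.u (rect D.lam z₀ h))⁻¹ * ∫⁻ z in rect D.lam z₀ r,
        ENNReal.ofReal (tilde f z) ^ (β * q) ∂(weightMeasure D.u)) ^ (1 / q) ≤
      ENNReal.ofReal (stepConst n m C₃ C₅ * (β * (h / (R - r)))) *
        muRatio D (rect D.lam z₀ h) *
        ((weightMeasure D.u (rect D.lam z₀ h))⁻¹ * ∫⁻ z in rect D.lam z₀ R,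
          ENNReal.ofReal (tilde f z) ^ (β * 2) ∂(weightMeasure D.u)) ^ (1 / 2 : ℝ) := by
  have hl := D.lam_admissible
  have hR : 0 < R := hr.trans hrR
  have hh : 0 < h := hR.trans_le hRh
  have hRQ : rect D.lam z₀ R ⊆ rect D.lam z₀ h := rect_mono hl hR hRh
  have hrQ : rect D.lam z₀ r ⊆ rect D.lam z₀ h := rect_mono hl hr (hrR.le.trans hRh)
  have hU0 := (weightMeasure_rect_pos hn hl D.u_weight hu z₀ hh).ne'
  have hUt := (weightMeasure_rect_lt_top D.u_weight D.lam z₀ h).ne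
  have hV0 := (weightMeasure_rect_pos hn hl D.v_weight hv z₀ hh).ne'
  have hμ := one_le_muRatio hn D hU0 hUt
  have hnn := hf.tilde_nonneg
  have hmeas : AEMeasurable (tilde f) ((weightMeasure D.u).restrict (rect D.lam z₀ h)) :=
    (Lp.aestronglyMeasurable (tilde f)).aemeasurable
  set Q := rect D.lam z₀ h with hQ
  set U := weightMeasure D.u with hU
  set V := weightMeasure D.v with hV
  set Y := ∫⁻ z in rect D.lam z₀ R, ENNReal.ofReal (tilde f z) ^ (β * 2) ∂U with hY
  have hpow : ∀ {t : ℝ} (_ : 0 ≤ t) (e : ℝ),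
      ENNReal.ofReal (t ^ β) ^ e = ENNReal.ofReal t ^ (β * e) := fun ht e => by
    rw [← ENNReal.ofReal_rpow_of_nonneg ht (by linarith), ENNReal.rpow_mul]
  have hquot : 1 ≤ β * (h / (R - r)) := by
    have : 1 ≤ h / (R - r) := by rw [le_div_iff₀ (by linarith)]; linarith
    nlinarith
  have hbound : ∀ k : ℕ, ((U Q)⁻¹ * ∫⁻ z in rect D.lam z₀ r,
      ENNReal.ofReal (truncPow β (k + 1) (tilde f z)) ^ q ∂U) ^ (1 / q) ≤
      ENNReal.ofReal (stepConst n m C₃ C₅ * (β * (h / (R - r)))) * muRatio D Q *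
        ((U Q)⁻¹ * Y) ^ (1 / 2 : ℝ) := by
    intro k
    have hN : (0 : ℝ) < k + 1 := by positivity
    obtain ⟨y, hy0, hy, hle⟩ := truncPow_step hn hC₅ hq hu hv hP hr hrR hRh hf hfs hβ hN
    have hnnR : ∀ᵐ z ∂(U.restrict (rect D.lam z₀ R)), 0 ≤ tilde f z :=
      ae_mono (Measure.restrict_mono hRQ le_rfl) hnn
    have hyY : ENNReal.ofReal y ≤ Y ^ (1 / 2 : ℝ) := by
      rw [← hy, eLpNorm_two_eq (hnnR.mono fun z hz => truncPow_nonneg hβ hz)]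
      refine ENNReal.rpow_le_rpow (lintegral_mono_ae ?_) (by norm_num)
      filter_upwards [hnnR] with z hz
      rw [← hpow hz]
      exact ENNReal.rpow_le_rpow (ENNReal.ofReal_le_ofReal (truncPow_le_rpow hβ hz)) (by norm_num)
    refine hle.trans ?_
    set s := √(10 * ((n : ℝ) + m)) with hs
    -- The constant `16` is the product of the `8` from the enclosing ball and the `2` from the
    -- cutoff slope.
    have e1 : C₅ * (8 * h) * ((V Q).toReal⁻¹ * (4 * 0 + 10 * β ^ 2 *
        ((n + m) * (2 / (R - r)) ^ 2) * y ^ 2)) ^ (1 / 2 : ℝ) =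
        C₅ * 16 * s * (β * (h / (R - r))) * ((V Q).toReal⁻¹ ^ (1 / 2 : ℝ) * y) := by
      have hRr : 0 < R - r := by linarith
      have h1 : 4 * 0 + 10 * β ^ 2 * (((n : ℝ) + m) * (2 / (R - r)) ^ 2) * y ^ 2 =
          (s * (β * (2 / (R - r))) * y) ^ 2 := by
        rw [mul_pow, mul_pow, hs, Real.sq_sqrt (by positivity)]
        ring
      rw [h1, Real.mul_rpow (by positivity) (by positivity), ← Real.sqrt_eq_rpow (_ ^ 2),
        Real.sqrt_sq (by positivity)]
      ring
    -- The identity `v(Q)^{-1/2} = μ(Q) u(Q)^{-1/2}` makes both terms averages for `u`.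
    have e2 : ENNReal.ofReal ((V Q).toReal⁻¹ ^ (1 / 2 : ℝ)) =
        muRatio D Q * (U Q)⁻¹ ^ (1 / 2 : ℝ) := by
      rw [← ENNReal.ofReal_rpow_of_nonneg (by positivity) (by norm_num), ← ENNReal.toReal_inv,
        ENNReal.ofReal_toReal (ENNReal.inv_ne_top.2 hV0), muRatio, ← hU, ← hV, mul_right_comm,
        ← ENNReal.mul_rpow_of_nonneg _ _ (by norm_num), ENNReal.mul_inv_cancel hU0 hUt,
        ENNReal.one_rpow, one_mul, ENNReal.rpow_neg, ENNReal.inv_rpow]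
    rw [e1, ENNReal.ofReal_mul (p := C₅ * 16 * s * (β * (h / (R - r)))) (by positivity),
      ENNReal.ofReal_mul (p := (V Q).toReal⁻¹ ^ (1 / 2 : ℝ)) (by positivity), e2,
      ENNReal.mul_rpow_of_nonneg _ _ (by norm_num)]
    set X := (U Q)⁻¹ ^ (1 / 2 : ℝ) with hX
    have hs1 : ENNReal.ofReal (C₅ * 16 * s * (β * (h / (R - r)))) *
        (muRatio D Q * X * ENNReal.ofReal y) + X * ENNReal.ofReal y ≤
        ENNReal.ofReal ((C₅ * 16 * s + 1) * (β * (h / (R - r)))) * muRatio D Q *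
          (X * Y ^ (1 / 2 : ℝ)) := by
      have h2 : ENNReal.ofReal ((C₅ * 16 * s + 1) * (β * (h / (R - r)))) =
          ENNReal.ofReal (C₅ * 16 * s * (β * (h / (R - r)))) +
            ENNReal.ofReal (β * (h / (R - r))) := by
        rw [add_mul, one_mul, ENNReal.ofReal_add (by positivity) (by linarith)]
      -- The undifferentiated term carries neither `β h/(R-r)` nor `μ(Q)`. Both are at least `1`, so
      -- they can be inserted and the two terms merged.
      have h3 : 1 ≤ ENNReal.ofReal (β * (h / (R - r))) * muRatio D Q := by
        refine one_le_mul ?_ hμ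
        rw [← ENNReal.ofReal_one]
        exact ENNReal.ofReal_le_ofReal hquot
      rw [h2, add_mul, add_mul]
      refine add_le_add ?_ ?_
      · calc _ = ENNReal.ofReal (C₅ * 16 * s * (β * (h / (R - r)))) * muRatio D Q *
              (X * ENNReal.ofReal y) := by ring
          _ ≤ _ := mul_le_mul_right (mul_le_mul_right hyY _) _
      · calc X * ENNReal.ofReal y ≤ 1 * (X * Y ^ (1 / 2 : ℝ)) := by
              rw [one_mul]; exact mul_le_mul_right hyY _
          _ ≤ _ := mul_le_mul_left h3 _
    refine (mul_le_mul_right hs1 _).trans_eq ?_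
    rw [stepConst, mul_assoc (max 1 C₃ ^ 3), ENNReal.ofReal_mul (p := max 1 C₃ ^ 3) (by positivity),
      ENNReal.ofReal_pow (by positivity)]
    ring
  have hmr : AEMeasurable (tilde f) (U.restrict (rect D.lam z₀ r)) :=
    hmeas.mono_measure (Measure.restrict_mono hrQ le_rfl)
  refine lintegral_rpow_le_of_tendsto (fun k => ?_) ?_ (by linarith) tendsto_const_nhds hbound
  · have hc := (lipschitzWith_truncPow hβ (show (0 : ℝ) ≤ k + 1 by positivity)).continuous
    exact ((hc.measurable.comp_aemeasurable hmr).ennreal_ofReal).pow_const q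
  · filter_upwards [ae_mono (Measure.restrict_mono hrQ le_rfl) hnn] with z hz
    refine tendsto_const_nhds.congr' ?_
    have ht : Tendsto (fun k : ℕ => (k : ℝ) + 1) atTop atTop :=
      tendsto_atTop_add_const_right _ _ tendsto_natCast_atTop_atTop
    filter_upwards [ht.eventually_ge_atTop (tilde f z)] with k hk
    rw [truncPow_of_le hβ hz hk, hpow hz]

end

/-! ### The iteration -/

theorem tendsto_rpow_inv_pow {x : ℝ≥0∞} (h0 : x ≠ 0) (ht : x ≠ ∞) {χ : ℝ} (hχ : 1 < χ) :
    Tendsto (fun i : ℕ => x ^ (1 / χ ^ i)) atTop (𝓝 1) := by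
  have h1 : Tendsto (fun i : ℕ => 1 / χ ^ i) atTop (𝓝 0) := by
    simpa only [one_div, Function.comp_def] using
      tendsto_inv_atTop_zero.comp (tendsto_pow_atTop_atTop_of_one_lt hχ)
  have hx : 0 < x.toReal := ENNReal.toReal_pos h0 ht
  have h2 : Tendsto (fun i : ℕ => x.toReal ^ (1 / χ ^ i)) atTop (𝓝 (x.toReal ^ (0 : ℝ))) :=
    ((Real.continuousAt_const_rpow hx.ne').tendsto).comp h1
  have h3 := (ENNReal.continuous_ofReal.tendsto _).comp h2
  rw [Real.rpow_zero, ENNReal.ofReal_one] at h3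
  refine h3.congr fun i => ?_
  rw [Function.comp_apply, ← ENNReal.ofReal_rpow_of_pos hx, ENNReal.ofReal_toReal ht]

/-- The essential supremum is controlled by any bound for a sequence of `L^p` means with
exponents tending to infinity geometrically. -/
theorem essSup_rpow_le {α : Type*} [MeasurableSpace α] {μ : Measure α} [IsFiniteMeasure μ]
    {F : α → ℝ≥0∞} (hF : AEMeasurable F μ) {c : ℝ≥0∞} (hc0 : c ≠ 0) (hct : c ≠ ∞) {p χ : ℝ}
    (hp : 0 < p) (hχ : 1 < χ) {T : ℝ≥0∞}
    (h : ∀ i : ℕ, (c * ∫⁻ z, F z ^ (p * χ ^ i) ∂μ) ^ (1 / χ ^ i) ≤ T) :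
    essSup F μ ^ p ≤ T := by
  rw [← ENNReal.le_rpow_inv_iff hp]
  refine le_of_forall_lt fun t ht => ?_
  by_contra hTt
  push Not at hTt
  obtain ⟨s, hts, hs⟩ := exists_between ht
  have hm : μ {z | s ≤ F z} ≠ 0 := by
    intro h0
    refine hs.not_ge (essSup_le_of_ae_le s ?_)
    have : ∀ᵐ z ∂μ, ¬ s ≤ F z := by simpa [ae_iff] using h0
    filter_upwards [this] with z hz using (not_le.1 hz).le
  have hχ0 : 0 < χ := by linarith
  -- Chebyshev's inequality at a level `s` below the essential supremum. The set has positive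
  -- measure, so the power `1/χ^i` of its measure tends to `1` and `s^p ≤ T` remains.
  have key : ∀ i : ℕ, (c * μ {z | s ≤ F z}) ^ (1 / χ ^ i) * s ^ p ≤ T := by
    intro i
    have hχi : 0 < χ ^ i := pow_pos hχ0 i
    refine le_trans ?_ (h i)
    have e : s ^ p = (s ^ (p * χ ^ i)) ^ (1 / χ ^ i) := by
      rw [← ENNReal.rpow_mul]; congr 1; field_simp
    rw [e, ← ENNReal.mul_rpow_of_nonneg _ _ (by positivity)]
    refine ENNReal.rpow_le_rpow ?_ (by positivity)
    rw [mul_assoc]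
    refine mul_le_mul_right ?_ c
    rw [mul_comm]
    refine le_trans (mul_le_mul_right (measure_mono fun z hz => ?_) _)
      (mul_meas_ge_le_lintegral₀ (hF.pow_const _) (s ^ (p * χ ^ i)))
    exact ENNReal.rpow_le_rpow hz (by positivity)
  have hlim : Tendsto (fun i : ℕ => (c * μ {z | s ≤ F z}) ^ (1 / χ ^ i) * s ^ p) atTop
      (𝓝 (1 * s ^ p)) :=
    ENNReal.Tendsto.mul_const (tendsto_rpow_inv_pow (mul_ne_zero hc0 hm)
      (ENNReal.mul_ne_top hct (measure_ne_top _ _)) hχ) (Or.inl one_ne_zero)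
  have h1 := le_of_tendsto' hlim key
  rw [one_mul, ← ENNReal.le_rpow_inv_iff hp] at h1
  exact (h1.trans hTt).not_gt hts

/-- The Moser iteration for sequences: from `A (i+1) ^ (1/χ) ≤ (K b^i)² A i` follows a uniform
bound for `A i ^ (1/χ^i)`. -/
theorem moser_iteration {A : ℕ → ℝ≥0∞} {K b : ℝ≥0∞} {χ : ℝ} (hχ : 1 < χ) (hK : 1 ≤ K)
    (hb : 1 ≤ b) (h : ∀ i, A (i + 1) ^ (1 / χ) ≤ (K * b ^ i) ^ 2 * A i) (i : ℕ) :
    A i ^ (1 / χ ^ i) ≤ K ^ (2 * (1 - χ⁻¹)⁻¹) * b ^ (2 * (χ⁻¹ / (1 - χ⁻¹) ^ 2)) * A 0 := by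
  have hχ0 : 0 < χ := by linarith
  have hx0 : 0 ≤ χ⁻¹ := by positivity
  have hx1 : χ⁻¹ < 1 := inv_lt_one_of_one_lt₀ hχ
  -- Unrolling the recursion raises the cost of step `j` to the power `χ^{-j}`. Both partial sums of
  -- exponents are then replaced by the full series, which is allowed because `K, b ≥ 1`.
  have hpart : ∀ i, A i ^ (1 / χ ^ i) ≤ K ^ (2 * ∑ j ∈ Finset.range i, χ⁻¹ ^ j) *
      b ^ (2 * ∑ j ∈ Finset.range i, (j : ℝ) * χ⁻¹ ^ j) * A 0 := by
    intro i
    induction i with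
    | zero => simp
    | succ i ih =>
      have hχi : 0 < χ ^ i := pow_pos hχ0 i
      have e : A (i + 1) ^ (1 / χ ^ (i + 1)) = (A (i + 1) ^ (1 / χ)) ^ (1 / χ ^ i) := by
        rw [← ENNReal.rpow_mul]; congr 1; rw [pow_succ]; field_simp
      have h1 : A (i + 1) ^ (1 / χ ^ (i + 1)) ≤
          ((K * b ^ i) ^ 2) ^ (1 / χ ^ i) * A i ^ (1 / χ ^ i) := by
        rw [e, ← ENNReal.mul_rpow_of_nonneg _ _ (by positivity)]
        exact ENNReal.rpow_le_rpow (h i) (by positivity)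
      have h2 : ((K * b ^ i) ^ 2) ^ (1 / χ ^ i) =
          K ^ (2 * χ⁻¹ ^ i) * b ^ (2 * ((i : ℝ) * χ⁻¹ ^ i)) := by
        rw [← ENNReal.rpow_natCast b i, ← ENNReal.rpow_natCast _ 2, ← ENNReal.rpow_mul,
          ENNReal.mul_rpow_of_nonneg _ _ (by positivity), ← ENNReal.rpow_mul, inv_pow, one_div]
        congr 2
        push_cast
        ring
      refine h1.trans ((mul_le_mul_right ih _).trans_eq ?_)
      rw [h2, Finset.sum_range_succ, Finset.sum_range_succ, mul_add, mul_add,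
        ENNReal.rpow_add_of_nonneg (x := K) _ _ (by positivity) (by positivity),
        ENNReal.rpow_add_of_nonneg (x := b) _ _ (by positivity) (by positivity)]
      ring
  have hn : ‖χ⁻¹‖ < 1 := by rwa [Real.norm_of_nonneg hx0]
  refine (hpart i).trans (mul_le_mul_left (mul_le_mul' ?_ ?_) _)
  · refine ENNReal.rpow_le_rpow_of_exponent_le hK (mul_le_mul_of_nonneg_left ?_ zero_le_two)
    rw [← tsum_geometric_of_lt_one hx0 hx1]
    exact (summable_geometric_of_lt_one hx0 hx1).sum_le_tsum _ fun j _ => by positivity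
  · refine ENNReal.rpow_le_rpow_of_exponent_le hb (mul_le_mul_of_nonneg_left ?_ zero_le_two)
    have := hasSum_coe_mul_geometric_of_norm_lt_one hn
    rw [← this.tsum_eq]
    exact this.summable.sum_le_tsum _ fun j _ => by positivity

end Grushin

end

/-- The measure `u(z) dz` is used for the essential supremum, since `f̃` is a class in
`L²(Q, u dz)`. Both sides are in `[0, ∞]`; `f̃` is non-negative almost everywhere for `u dz`. -/
theorem proposition4p2 (n m : ℕ) (hn : 1 ≤ n) (hm : 1 ≤ m)
    (C₁ C₂ C₃ C₄ C₅ q : ℝ) (hC₁ : 0 < C₁) (hC₂ : 0 < C₂) (hC₃ : 0 < C₃) (hC₄ : 0 < C₄)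
    (hC₅ : 0 < C₅) (hq : 2 < q) :
    ∃ C₁₂ δ : ℝ, 0 < C₁₂ ∧ 0 < δ ∧
      ∀ D : Grushin.Operator n m,
        Grushin.LamDoubling D.lam C₁ → Grushin.LamSupMean D.lam C₂ →
        Grushin.WeightDoubling D.lam D.u C₃ → Grushin.WeightDoubling D.lam D.v C₄ →
        Grushin.SobolevPoincare D.lam D.u D.v q C₅ →
        ∀ (z₀ : GPt n m) (h : ℝ), 0 < h →
          ∀ f : Grushin.H D (Grushin.rectDomain D.lam z₀ h),
            Grushin.IsNonneg f → Grushin.IsSubsolution f →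
            ∀ a : ℝ, 1 / 2 ≤ a → a < 1 → ∀ p : ℝ, 2 ≤ p →
              essSup (fun z => ENNReal.ofReal (Grushin.tilde f z))
                  ((Grushin.weightMeasure D.u).restrict (Grushin.rect D.lam z₀ (a * h))) ^ p ≤
                ENNReal.ofReal (C₁₂ / (1 - a) ^ δ) *
                  (ENNReal.ofReal p * Grushin.muRatio D (Grushin.rect D.lam z₀ h)) ^
                    (2 * q / (q - 2)) *
                  ((Grushin.weightMeasure D.u (Grushin.rect D.lam z₀ h))⁻¹ *
                    ∫⁻ z in Grushin.rect D.lam z₀ h,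
                      ENNReal.ofReal (Grushin.tilde f z) ^ p ∂(Grushin.weightMeasure D.u)) := by
  -- `δ` equals `2 ∑ χ^{-j}`, the total exponent of the factor `K` in the iteration.
  set δ : ℝ := 2 * q / (q - 2) with hδ
  set χ : ℝ := q / 2 with hχd
  have hχ : 1 < χ := by rw [hχd]; linarith
  have hδ0 : 0 < δ := div_pos (by linarith) (by linarith)
  -- `S` is `2 ∑ j χ^{-j}`, the total exponent of the geometric growth rate `q` of the step
  -- constants.
  set S : ℝ := 2 * (χ⁻¹ / (1 - χ⁻¹) ^ 2) with hS
  set K₀ : ℝ := Grushin.stepConst n m C₃ C₅ with hK₀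
  have hK₀1 : 1 ≤ K₀ := by
    rw [hK₀, Grushin.stepConst]
    have h1 : (1 : ℝ) ≤ max 1 C₃ ^ 3 := one_le_pow₀ (le_max_left _ _)
    have h2 : (1 : ℝ) ≤ C₅ * 16 * √(10 * (n + m)) + 1 := by
      have : 0 ≤ C₅ * 16 * √(10 * (n + m)) := by positivity
      linarith
    nlinarith
  refine ⟨K₀ ^ δ * q ^ S, δ, by positivity, hδ0, ?_⟩
  intro D _ _ hu hv hP z₀ h hh f hf hfs a ha ha1 p hp
  have hl := D.lam_admissible
  set Q := Grushin.rect D.lam z₀ h with hQ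
  set U := Grushin.weightMeasure D.u with hU
  set F : GPt n m → ℝ≥0∞ := fun z => ENNReal.ofReal (Grushin.tilde f z) with hF
  set μQ := Grushin.muRatio D Q with hμQ
  have hU0 : U Q ≠ 0 := (Grushin.weightMeasure_rect_pos hn hl D.u_weight hu z₀ hh).ne'
  have hUt : U Q ≠ ∞ := (Grushin.weightMeasure_rect_lt_top D.u_weight D.lam z₀ h).ne
  have hμ1 : 1 ≤ μQ := Grushin.one_le_muRatio hn D hU0 hUt
  -- Radii decrease from `h` towards `a h` with gaps `(1-a) h / 2^{i+1}`, and all of them stay above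
  -- `a h`.
  set r : ℕ → ℝ := fun i => (a + (1 - a) / 2 ^ i) * h with hr
  have hr0 : ∀ i, a * h < r i := fun i => by
    refine mul_lt_mul_of_pos_right ?_ hh
    have : 0 < (1 - a) / 2 ^ i := div_pos (by linarith) (by positivity)
    linarith
  have hah : 0 < a * h := by positivity
  have hrh : ∀ i, r i ≤ h := fun i => by
    have h1 : (1 - a) / 2 ^ i ≤ 1 - a :=
      div_le_self (by linarith) (one_le_pow₀ one_le_two)
    exact mul_le_of_le_one_left hh.le (by linarith)
  have hdiff : ∀ i, r i - r (i + 1) = (1 - a) / 2 ^ (i + 1) * h := fun i => by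
    simp only [hr]
    rw [pow_succ]
    field_simp
    ring
  have hrlt : ∀ i, r (i + 1) < r i := fun i => by
    have : 0 < (1 - a) / 2 ^ (i + 1) * h :=
      mul_pos (div_pos (by linarith) (by positivity)) hh
    linarith [hdiff i]
  set A : ℕ → ℝ≥0∞ := fun i => (U Q)⁻¹ *
    ∫⁻ z in Grushin.rect D.lam z₀ (r i), F z ^ (p * χ ^ i) ∂U with hA
  set K : ℝ≥0∞ := ENNReal.ofReal (K₀ / (1 - a)) * (ENNReal.ofReal p * μQ) with hK
  have h1a : 0 < 1 - a := by linarith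
  have hK1 : 1 ≤ K := by
    refine one_le_mul ?_ (one_le_mul ?_ hμ1) <;> rw [← ENNReal.ofReal_one] <;>
      refine ENNReal.ofReal_le_ofReal ?_
    · rw [le_div_iff₀ h1a]; linarith
    · linarith
  have hb1 : 1 ≤ ENNReal.ofReal q := by
    rw [← ENNReal.ofReal_one]; exact ENNReal.ofReal_le_ofReal (by linarith)
  have hstep : ∀ i, A (i + 1) ^ (1 / χ) ≤ (K * ENNReal.ofReal q ^ i) ^ 2 * A i := by
    intro i
    have hχi : 1 ≤ χ ^ i := one_le_pow₀ hχ.le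
    have hβ : 1 ≤ p * χ ^ i / 2 := by nlinarith
    have key := Grushin.reverse_holder hn hC₅ hq hu hv hP (hah.trans (hr0 (i + 1))) (hrlt i)
      (hrh i) hf hfs hβ
    have e1 : p * χ ^ i / 2 * q = p * χ ^ (i + 1) := by rw [pow_succ, hχd]; ring
    have e2 : p * χ ^ i / 2 * 2 = p * χ ^ i := by ring
    -- The rate `q^i` is the product of `χ^i = (q/2)^i` from the exponent and `2^i` from the
    -- shrinking gaps. The remaining factors of `2` cancel.
    have e3 : K₀ * (p * χ ^ i / 2 * (h / (r i - r (i + 1)))) = K₀ / (1 - a) * (p * q ^ i) := by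
      rw [hdiff, hχd, div_pow, pow_succ]
      field_simp
    rw [e1, e2, ← hK₀, e3, ENNReal.ofReal_mul (by positivity), ENNReal.ofReal_mul (by linarith),
      ENNReal.ofReal_pow (by linarith)] at key
    have key' : A (i + 1) ^ (1 / q) ≤ K * ENNReal.ofReal q ^ i * A i ^ (1 / 2 : ℝ) := by
      refine key.trans_eq ?_
      rw [hK]
      ring
    -- As `1/χ = 2/q`, squaring the reverse Hölder inequality puts it in the form required by the
    -- iteration.
    have e4 : A (i + 1) ^ (1 / χ) = (A (i + 1) ^ (1 / q)) ^ 2 := by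
      rw [← ENNReal.rpow_natCast, ← ENNReal.rpow_mul, hχd]
      congr 1
      push_cast
      field_simp
    have e5 : (A i ^ (1 / 2 : ℝ)) ^ 2 = A i := by
      rw [← ENNReal.rpow_natCast, ← ENNReal.rpow_mul]
      simp
    rw [e4]
    calc (A (i + 1) ^ (1 / q)) ^ 2 ≤ (K * ENNReal.ofReal q ^ i * A i ^ (1 / 2 : ℝ)) ^ 2 :=
          pow_le_pow_left₀ zero_le key' 2
      _ = _ := by rw [mul_pow, e5]
  have hiter := Grushin.moser_iteration hχ hK1 hb1 hstep
  have hfin : IsFiniteMeasure (U.restrict (Grushin.rect D.lam z₀ (a * h))) := ⟨by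
    rw [Measure.restrict_apply_univ]
    exact Grushin.weightMeasure_rect_lt_top D.u_weight D.lam z₀ (a * h)⟩
  have hahh : a * h ≤ h := mul_le_of_le_one_left hh.le ha1.le
  have hmeas : AEMeasurable F (U.restrict (Grushin.rect D.lam z₀ (a * h))) :=
    ((Lp.aestronglyMeasurable (Grushin.tilde f)).aemeasurable.mono_measure
      (Measure.restrict_mono (Grushin.rect_mono hl hah hahh) le_rfl)).ennreal_ofReal
  refine (Grushin.essSup_rpow_le
    (T := ENNReal.ofReal (K₀ ^ δ * q ^ S / (1 - a) ^ δ) * (ENNReal.ofReal p * μQ) ^ δ * A 0)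
    hmeas (ENNReal.inv_ne_zero.2 hUt) (ENNReal.inv_ne_top.2 hU0)
    (by linarith) hχ fun i => ?_).trans_eq ?_
  · refine le_trans (ENNReal.rpow_le_rpow (mul_le_mul_right
      (lintegral_mono_set (Grushin.rect_mono hl hah (hr0 i).le)) _) (by positivity))
      ((hiter i).trans_eq ?_)
    have e6 : 2 * (1 - χ⁻¹)⁻¹ = δ := by
      have : q - 2 ≠ 0 := by linarith
      rw [hδ, hχd]
      field_simp
    have e7 : K₀ ^ δ * q ^ S / (1 - a) ^ δ = (K₀ / (1 - a)) ^ δ * q ^ S := by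
      rw [Real.div_rpow (by linarith) h1a.le]; ring
    rw [e6, hK, ENNReal.mul_rpow_of_nonneg _ _ hδ0.le, e7, ENNReal.ofReal_mul (by positivity),
      ← ENNReal.ofReal_rpow_of_pos (by positivity), ← ENNReal.ofReal_rpow_of_pos (by linarith)]
    ring
  · have hr00 : r 0 = h := by simp [hr]
    simp only [hA, hr00, pow_zero, mul_one]
    rfl
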